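/- Let $n\geq 2$ be an integer and let $a>0$. Equip $\mathbb{R}^{2n}$, with coordinates $q^1,p_1,\ldots,q^n,p_n$, with the standard symplectic form $\omega_0=\sum_{i=1}^n dq^i\wedge dp_i$, and denote by $B^m_1$ the open unit ball around $0$ in $\mathbb{R}^m$. A symplectic embedding of an open set $U\subseteq\mathbb{R}^{2n}$ is a smooth map $\psi:U\to\mathbb{R}^{2n}$ that is a homeomorphism onto its image and satisfies $\psi^*\omega_0=\omega_0$. For $A\subseteq\mathbb{R}^{2n}$ and $z\in\mathbb{R}^{2n-2}$, the section of $A$ at $z$ is the set $\{y\in\mathbb{R}^2 : (y,z)\in A\}$. The bounded hull of a bounded set $S\subseteq\mathbb{R}^2$ is the union of $S$ and all bounded connected components of $\mathbb{R}^2\setminus S$. Then there exists a symplectic embedding $\psi$ of $B^{2n}_1$ into $\mathbb{R}^{2n}$ with $\psi(B^{2n}_1)\subseteq B^2_1\times\mathbb{R}^{2n-2}$ such that, for every $z\in\mathbb{R}^{2n-2}$, the bounded hull of the section of $\psi(B^{2n}_1)$ at $z$ has area (two-dimensional Lebesgue measure) at most $a$. -/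

import Mathlib

open Set MeasureTheory
open scoped ContDiff

noncomputable section

/-- The plane `ℝ²` with its Euclidean norm and Lebesgue measure (area). -/
abbrev Plane : Type := EuclideanSpace ℝ (Fin 2)

/-- The space `ℝ²ⁿ` with its Euclidean norm. The coordinates of `x` are
`q¹, p₁, …, qⁿ, pₙ`, where `x (i, 0)` is the `q`- and `x (i, 1)` the `p`-coordinate of the
`i`-th pair, `i = 0, …, n - 1`. -/
abbrev PhaseSpace (n : ℕ) : Type := EuclideanSpace ℝ (Fin n × Fin 2)

/-- The standard symplectic form `ω₀ = ∑ dqⁱ ∧ dpᵢ`. -/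
def stdSymplecticForm {n : ℕ} (u v : PhaseSpace n) : ℝ :=
  ∑ i : Fin n, (u (i, 0) * v (i, 1) - u (i, 1) * v (i, 0))

/-- `ψ` restricts to a symplectic embedding of the open set `U` into `ℝ²ⁿ`: it is smooth on `U`,
a homeomorphism from `U` onto its image, and pulls `ω₀` back to `ω₀` on `U`. (The last condition
makes the derivative injective, as `ω₀` is nondegenerate, so that `ψ` is an immersion on `U`.)
The values of `ψ` outside of `U` play no role. -/
structure IsSymplecticEmbeddingOn {n : ℕ} (ψ : PhaseSpace n → PhaseSpace n)
    (U : Set (PhaseSpace n)) : Prop where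
  isOpen : IsOpen U
  contDiffOn : ContDiffOn ℝ ∞ ψ U
  isEmbedding : Topology.IsEmbedding (U.domRestrict ψ)
  symplectic : ∀ x ∈ U, ∀ u v : PhaseSpace n,
    stdSymplecticForm (fderiv ℝ ψ x u) (fderiv ℝ ψ x v) = stdSymplecticForm u v

/-- The map `ι_z : ℝ² → ℝ²ⁿ`, `y ↦ (y, z)`, for `z ∈ ℝ²ⁿ⁻²` (with `n ≥ 1`). -/
def planeInclusion {n : ℕ} (z : PhaseSpace (n - 1)) (y : Plane) : PhaseSpace n :=
  WithLp.toLp 2 fun k =>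
    if h : (k.1 : ℕ) = 0 then y k.2 else z (⟨(k.1 : ℕ) - 1, by omega⟩, k.2)

/-- The open cylinder `B²_r × ℝ²ⁿ⁻²`, consisting of the points `(y, z)` with `y` in the open
disc of radius `r` around `0` and `z ∈ ℝ²ⁿ⁻²`. -/
def openCylinder (n : ℕ) (r : ℝ) : Set (PhaseSpace n) :=
  {x | ∃ y ∈ Metric.ball (0 : Plane) r, ∃ z : PhaseSpace (n - 1), x = planeInclusion z y}

/-- The section of `A ⊆ ℝ²ⁿ` at `z ∈ ℝ²ⁿ⁻²`, i.e., the preimage of `A` under `y ↦ (y, z)`. -/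
def planeSection {n : ℕ} (A : Set (PhaseSpace n)) (z : PhaseSpace (n - 1)) : Set Plane :=
  planeInclusion z ⁻¹' A

/-- The bounded hull of `S`: the union of `S` and all bounded connected components of the
complement of `S`. -/
def boundedHull {X : Type*} [PseudoMetricSpace X] (S : Set X) : Set X :=
  S ∪ ⋃₀ {C | (∃ x ∈ Sᶜ, C = connectedComponentIn Sᶜ x) ∧ Bornology.IsBounded C}

end

/-! The open unit disc is, up to a factor in the area form, the sphere minus one point, and the
boundary circle corresponds to the missing point. Write H = q u, r² = q² + p², and (q₂, p₂) for the
second pair. `thinEmbedding` composes three Hamiltonian maps. Each turns the disc of the first pair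
into itself, so the cylinder condition is automatic, and shifts one coordinate of the second pair.
They are symplectic because the change of the area form caused by a variable angle
(`derivRot_wedge`) cancels against the shift.

The middle map raises p₂ by a hill of slope -1/d² in r². Since |p₂| < 1 on the ball, fixing the new
p₂ leaves only rings of area of order d². Their hulls may still be large, so the rings must be cut.
The last map shifts q₂ by about ±2 according to the sign of H, so fixing q₂ removes one half of each
ring. This map also twists the section by `diskTwist`, an area-preserving homeomorphism on the disc
that is the identity outside, which affects neither areas nor the topological argument.

Near the boundary circle H tends to 0 and the step loses its height. There the first map does the
cutting: it shifts q₂ by H + H³ while rotating the sphere, and by `rotated_height_le` the image of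
the ball then misses a suitable ray. So, before the twist, a ray to infinity avoids the section
outside a disc of radius 4d² (`exists_ray`). A circle about 0 that avoids the thin set `radialBound`
forms with this ray an unbounded connected set missing the section. Hence the hull lies in the
twisted `radialBound` (`boundedHull_planeSection_subset`), of area at most d
(`volume_radialBound_le`). -/

noncomputable section

/-! ### Rotations of the sphere in a Lambert chart

The open unit disc is the complement of a point in the sphere, `(q, p)` corresponding to
`(2 q u, 2 p u, 2 (q² + p²) - 1)` with `u = √(1 - q² - p²)`. -/

/-- The function `u = √(1 - q² - p²)`. -/
def coheight (q p : ℝ) : ℝ := √(1 - (q ^ 2 + p ^ 2))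

/-- The Hamiltonian `q u` generating the rotations about the first axis. -/
def discHam (q p : ℝ) : ℝ := q * coheight q p

/-- The second coordinate of the rotated point of the sphere. -/
def rotY (q p b : ℝ) : ℝ :=
  2 * p * coheight q p * Real.cos b + (2 * (q ^ 2 + p ^ 2) - 1) * Real.sin b

/-- The third coordinate of the rotated point of the sphere. -/
def rotZ (q p b : ℝ) : ℝ :=
  (2 * (q ^ 2 + p ^ 2) - 1) * Real.cos b - 2 * p * coheight q p * Real.sin b

/-- The first coordinate of the rotated point in the disc. -/
def rotQ (q p b : ℝ) : ℝ := 2 * discHam q p / √(2 * (1 - rotZ q p b))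

/-- The second coordinate of the rotated point in the disc. -/
def rotP (q p b : ℝ) : ℝ := rotY q p b / √(2 * (1 - rotZ q p b))

section Rotation

variable {q p b : ℝ}

lemma coheight_sq (h : q ^ 2 + p ^ 2 < 1) : coheight q p ^ 2 = 1 - (q ^ 2 + p ^ 2) :=
  Real.sq_sqrt (by linarith)

lemma coheight_pos (h : q ^ 2 + p ^ 2 < 1) : 0 < coheight q p :=
  Real.sqrt_pos.2 (by linarith)

lemma rot_sphere (h : q ^ 2 + p ^ 2 < 1) :
    (2 * discHam q p) ^ 2 + rotY q p b ^ 2 + rotZ q p b ^ 2 = 1 := by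
  have hu := coheight_sq h
  have hb := Real.sin_sq_add_cos_sq b
  unfold discHam rotY rotZ
  have h1 : (2 * (q * coheight q p)) ^ 2 + (2 * p * coheight q p * Real.cos b
      + (2 * (q ^ 2 + p ^ 2) - 1) * Real.sin b) ^ 2
      + ((2 * (q ^ 2 + p ^ 2) - 1) * Real.cos b - 2 * p * coheight q p * Real.sin b) ^ 2
      = 4 * q ^ 2 * coheight q p ^ 2 + (4 * p ^ 2 * coheight q p ^ 2
      + (2 * (q ^ 2 + p ^ 2) - 1) ^ 2) * (Real.sin b ^ 2 + Real.cos b ^ 2) := by ring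
  rw [h1, hb, hu]; ring

lemma rot_norm_sq (h : q ^ 2 + p ^ 2 < 1) (hz : rotZ q p b < 1) :
    rotQ q p b ^ 2 + rotP q p b ^ 2 = (1 + rotZ q p b) / 2 := by
  have hs := rot_sphere (b := b) h
  have hd : 0 < 2 * (1 - rotZ q p b) := by linarith
  rw [rotQ, rotP, div_pow, div_pow, Real.sq_sqrt hd.le, ← add_div, div_eq_div_iff hd.ne' two_ne_zero]
  linear_combination 2 * hs

lemma rot_norm_lt (h : q ^ 2 + p ^ 2 < 1) (hz : rotZ q p b < 1) :
    rotQ q p b ^ 2 + rotP q p b ^ 2 < 1 := by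
  rw [rot_norm_sq h hz]; linarith

/-- The square root dividing in `rotQ` and `rotP` is twice the value of u at the image point. This
is what makes them the inverse of the Lambert chart. -/
lemma coheight_rot (h : q ^ 2 + p ^ 2 < 1) (hz : rotZ q p b < 1) :
    coheight (rotQ q p b) (rotP q p b) = √(2 * (1 - rotZ q p b)) / 2 := by
  rw [coheight, rot_norm_sq h hz, show 1 - (1 + rotZ q p b) / 2 = 2 * (1 - rotZ q p b) / 2 ^ 2 by ring,
    Real.sqrt_div' _ (by positivity), Real.sqrt_sq (by positivity)]

lemma discHam_rot (h : q ^ 2 + p ^ 2 < 1) (hz : rotZ q p b < 1) :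
    discHam (rotQ q p b) (rotP q p b) = discHam q p := by
  have hd : 0 < √(2 * (1 - rotZ q p b)) := Real.sqrt_pos.2 (by linarith)
  rw [discHam, coheight_rot h hz, rotQ]; field_simp

lemma rotP_mul_coheight (h : q ^ 2 + p ^ 2 < 1) (hz : rotZ q p b < 1) :
    2 * rotP q p b * coheight (rotQ q p b) (rotP q p b) = rotY q p b := by
  have hd : 0 < √(2 * (1 - rotZ q p b)) := Real.sqrt_pos.2 (by linarith)
  rw [coheight_rot h hz, rotP]; field_simp

lemma rotZ_rot_neg (h : q ^ 2 + p ^ 2 < 1) (hz : rotZ q p b < 1) :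
    rotZ (rotQ q p b) (rotP q p b) (-b) = 2 * (q ^ 2 + p ^ 2) - 1 := by
  rw [rotZ, rotP_mul_coheight h hz, rot_norm_sq h hz, Real.cos_neg, Real.sin_neg]
  unfold rotY rotZ
  linear_combination (2 * (q ^ 2 + p ^ 2) - 1) * Real.sin_sq_add_cos_sq b

lemma rotY_rot_neg (h : q ^ 2 + p ^ 2 < 1) (hz : rotZ q p b < 1) :
    rotY (rotQ q p b) (rotP q p b) (-b) = 2 * p * coheight q p := by
  rw [rotY, rotP_mul_coheight h hz, rot_norm_sq h hz, Real.cos_neg, Real.sin_neg]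
  unfold rotY rotZ
  linear_combination (2 * p * coheight q p) * Real.sin_sq_add_cos_sq b

lemma sqrt_chart (h : q ^ 2 + p ^ 2 < 1) :
    √(2 * (1 - (2 * (q ^ 2 + p ^ 2) - 1))) = 2 * coheight q p := by
  rw [show 2 * (1 - (2 * (q ^ 2 + p ^ 2) - 1)) = (2 * coheight q p) ^ 2 by
    rw [mul_pow, coheight_sq h]; ring, Real.sqrt_sq (by have := coheight_pos h; positivity)]

lemma rotQ_rot_neg (h : q ^ 2 + p ^ 2 < 1) (hz : rotZ q p b < 1) :
    rotQ (rotQ q p b) (rotP q p b) (-b) = q := by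
  have hu := coheight_pos h
  rw [rotQ, rotZ_rot_neg h hz, discHam_rot h hz, sqrt_chart h, discHam]; field_simp

lemma rotP_rot_neg (h : q ^ 2 + p ^ 2 < 1) (hz : rotZ q p b < 1) :
    rotP (rotQ q p b) (rotP q p b) (-b) = p := by
  have hu := coheight_pos h
  rw [rotP, rotZ_rot_neg h hz, rotY_rot_neg h hz, sqrt_chart h]; field_simp

lemma rotZ_zero : rotZ q p 0 = 2 * (q ^ 2 + p ^ 2) - 1 := by simp [rotZ]

lemma rotQ_zero (h : q ^ 2 + p ^ 2 < 1) : rotQ q p 0 = q := by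
  have hu := coheight_pos h
  rw [rotQ, rotZ_zero, sqrt_chart h, discHam]; field_simp

lemma rotP_zero (h : q ^ 2 + p ^ 2 < 1) : rotP q p 0 = p := by
  have hu := coheight_pos h
  rw [rotP, rotZ_zero, sqrt_chart h, rotY]; simp; field_simp

/-- Only points of the great circle `q = 0` can be rotated into the missing point of the sphere. -/
lemma rotZ_lt_one (h : q ^ 2 + p ^ 2 < 1) (hb : discHam q p = 0 → rotZ q p b < 1) :
    rotZ q p b < 1 := by
  by_cases h0 : discHam q p = 0
  · exact hb h0
  have hs := rot_sphere (b := b) h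
  have : 0 < discHam q p ^ 2 := by positivity
  nlinarith [sq_nonneg (rotY q p b)]

end Rotation

/-! ### Differentials of the rotations and the area form -/

section Derivative

variable {q p b : ℝ → ℝ} {q' p' b' t : ℝ}

lemma HasDerivAt.coheight (h : q t ^ 2 + p t ^ 2 < 1) (hq : HasDerivAt q q' t)
    (hp : HasDerivAt p p' t) :
    HasDerivAt (fun s => coheight (q s) (p s))
      (-(q t * q' + p t * p') / coheight (q t) (p t)) t := by
  have h1 : HasDerivAt (fun s => 1 - (q s ^ 2 + p s ^ 2)) (-(2 * q t * q' + 2 * p t * p')) t := by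
    have := ((hq.pow 2).add (hp.pow 2)).const_sub 1
    refine this.congr_deriv ?_
    simp
  refine (h1.sqrt (by linarith)).congr_deriv ?_
  have hu := coheight_pos h
  change _ / (2 * _root_.coheight (q t) (p t)) = _
  field_simp

lemma HasDerivAt.discHam (h : q t ^ 2 + p t ^ 2 < 1) (hq : HasDerivAt q q' t)
    (hp : HasDerivAt p p' t) :
    HasDerivAt (fun s => discHam (q s) (p s)) (q' * _root_.coheight (q t) (p t)
      + q t * (-(q t * q' + p t * p') / _root_.coheight (q t) (p t))) t :=
  hq.mul (hq.coheight h hp)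

/-- The derivative of `2 p u`. -/
def dualY (q p q' p' : ℝ) : ℝ :=
  2 * (p' * coheight q p + p * (-(q * q' + p * p') / coheight q p))

/-- The derivative of `2 q u`. -/
def dualX (q p q' p' : ℝ) : ℝ :=
  2 * (q' * coheight q p + q * (-(q * q' + p * p') / coheight q p))

/-- The derivative of `2 (q² + p²) - 1`. -/
def dualZ (q p q' p' : ℝ) : ℝ := 4 * (q * q' + p * p')

/-- The derivative of `rotY`. -/
def derivRotY (q p b q' p' b' : ℝ) : ℝ :=
  dualY q p q' p' * Real.cos b + dualZ q p q' p' * Real.sin b + rotZ q p b * b'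

/-- The derivative of `rotZ`. -/
def derivRotZ (q p b q' p' b' : ℝ) : ℝ :=
  dualZ q p q' p' * Real.cos b - dualY q p q' p' * Real.sin b - rotY q p b * b'

lemma hasDerivAt_rotY_rotZ (h : q t ^ 2 + p t ^ 2 < 1) (hq : HasDerivAt q q' t)
    (hp : HasDerivAt p p' t) (hb : HasDerivAt b b' t) :
    HasDerivAt (fun s => rotY (q s) (p s) (b s)) (derivRotY (q t) (p t) (b t) q' p' b') t ∧
    HasDerivAt (fun s => rotZ (q s) (p s) (b s)) (derivRotZ (q t) (p t) (b t) q' p' b') t := by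
  have hY : HasDerivAt (fun s => 2 * p s * coheight (q s) (p s))
      (dualY (q t) (p t) q' p') t := by
    refine ((hp.const_mul 2).mul (hq.coheight h hp)).congr_deriv ?_
    unfold dualY; ring
  have hZ : HasDerivAt (fun s => 2 * (q s ^ 2 + p s ^ 2) - 1) (dualZ (q t) (p t) q' p') t := by
    refine ((((hq.pow 2).add (hp.pow 2)).const_mul 2).sub_const 1).congr_deriv ?_
    unfold dualZ; simp; ring
  constructor
  · refine ((hY.mul hb.cos).add (hZ.mul hb.sin)).congr_deriv ?_
    unfold derivRotY rotZ; ring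
  · refine ((hZ.mul hb.cos).sub (hY.mul hb.sin)).congr_deriv ?_
    unfold derivRotZ rotY; ring

/-- The derivative of `rotQ`. -/
def derivRotQ (q p b q' p' b' : ℝ) : ℝ :=
  dualX q p q' p' / √(2 * (1 - rotZ q p b))
    + 2 * discHam q p * derivRotZ q p b q' p' b' / √(2 * (1 - rotZ q p b)) ^ 3

/-- The derivative of `rotP`. -/
def derivRotP (q p b q' p' b' : ℝ) : ℝ :=
  derivRotY q p b q' p' b' / √(2 * (1 - rotZ q p b))
    + rotY q p b * derivRotZ q p b q' p' b' / √(2 * (1 - rotZ q p b)) ^ 3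

lemma hasDerivAt_rotQ_rotP (h : q t ^ 2 + p t ^ 2 < 1) (hz : rotZ (q t) (p t) (b t) < 1)
    (hq : HasDerivAt q q' t) (hp : HasDerivAt p p' t) (hb : HasDerivAt b b' t) :
    HasDerivAt (fun s => rotQ (q s) (p s) (b s)) (derivRotQ (q t) (p t) (b t) q' p' b') t ∧
    HasDerivAt (fun s => rotP (q s) (p s) (b s)) (derivRotP (q t) (p t) (b t) q' p' b') t := by
  obtain ⟨hY, hZ⟩ := hasDerivAt_rotY_rotZ h hq hp hb
  have hd : 0 < 2 * (1 - rotZ (q t) (p t) (b t)) := by linarith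
  have hs : 0 < √(2 * (1 - rotZ (q t) (p t) (b t))) := Real.sqrt_pos.2 hd
  have hS := ((hZ.const_sub 1).const_mul 2).sqrt hd.ne'
  constructor
  · refine (((hq.discHam h hp).const_mul 2).div hS hs.ne').congr_deriv ?_
    unfold derivRotQ dualX
    field_simp
    ring
  · refine (hY.div hS hs.ne').congr_deriv ?_
    unfold derivRotP
    field_simp
    ring

end Derivative

/-- The area form on the disc under a rotation with variable angle. -/
lemma derivRot_wedge {q p b : ℝ} (h : q ^ 2 + p ^ 2 < 1) (hz : rotZ q p b < 1)
    (q₁ p₁ b₁ q₂ p₂ b₂ : ℝ) :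
    derivRotQ q p b q₁ p₁ b₁ * derivRotP q p b q₂ p₂ b₂
      - derivRotP q p b q₁ p₁ b₁ * derivRotQ q p b q₂ p₂ b₂
    = (q₁ * p₂ - p₁ * q₂)
      - (dualX q p q₁ p₁ * b₂ - b₁ * dualX q p q₂ p₂) / 4 := by
  have hu := coheight_pos h
  have hu2 := coheight_sq h
  have hsph := rot_sphere (b := b) h
  have hd : 0 < 2 * (1 - rotZ q p b) := by linarith
  have hs : 0 < √(2 * (1 - rotZ q p b)) := Real.sqrt_pos.2 hd
  have hs2 : √(2 * (1 - rotZ q p b)) ^ 2 = 2 * (1 - rotZ q p b) := Real.sq_sqrt hd.le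
  have hb := Real.sin_sq_add_cos_sq b
  set w := q₁ * p₂ - p₁ * q₂ with hw
  -- the wedge products of the differentials of the three coordinates on the sphere
  have hXY : dualX q p q₁ p₁ * dualY q p q₂ p₂ - dualY q p q₁ p₁ * dualX q p q₂ p₂
      = -4 * (2 * (q ^ 2 + p ^ 2) - 1) * w := by
    unfold dualX dualY
    field_simp
    rw [hw]
    linear_combination (4 * (q₁ * p₂ - p₁ * q₂) * coheight q p ^ 2) * hu2
  have hYZ : dualY q p q₁ p₁ * dualZ q p q₂ p₂ - dualZ q p q₁ p₁ * dualY q p q₂ p₂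
      = -4 * (2 * discHam q p) * w := by
    unfold dualZ dualY discHam
    field_simp
    rw [hw]
    ring
  have hZX : dualZ q p q₁ p₁ * dualX q p q₂ p₂ - dualX q p q₁ p₁ * dualZ q p q₂ p₂
      = -4 * (2 * p * coheight q p) * w := by
    unfold dualZ dualX
    field_simp
    rw [hw]
    ring
  -- The differentiated sphere equation: X dX + Y dY + Z dZ = 0.
  have hrad : ∀ a c : ℝ, 2 * discHam q p * dualX q p a c + 2 * p * coheight q p * dualY q p a c
      + (2 * (q ^ 2 + p ^ 2) - 1) * dualZ q p a c = 0 := by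
    intro a c
    unfold dualX dualY dualZ discHam
    field_simp
    linear_combination (4 * (q * a + p * c)) * hu2
  have hrad₁ := hrad q₁ p₁
  have hrad₂ := hrad q₂ p₂
  unfold derivRotQ derivRotP
  set s := √(2 * (1 - rotZ q p b)) with hsdef
  set C := Real.cos b
  set S := Real.sin b
  set X := 2 * discHam q p with hX
  set X₁ := dualX q p q₁ p₁
  set X₂ := dualX q p q₂ p₂
  have hY₁ : derivRotY q p b q₁ p₁ b₁
    = dualY q p q₁ p₁ * C + dualZ q p q₁ p₁ * S + rotZ q p b * b₁ := rfl
  have hY₂ : derivRotY q p b q₂ p₂ b₂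
    = dualY q p q₂ p₂ * C + dualZ q p q₂ p₂ * S + rotZ q p b * b₂ := rfl
  have hZ₁ : derivRotZ q p b q₁ p₁ b₁
    = dualZ q p q₁ p₁ * C - dualY q p q₁ p₁ * S - rotY q p b * b₁ := rfl
  have hZ₂ : derivRotZ q p b q₂ p₂ b₂
    = dualZ q p q₂ p₂ * C - dualY q p q₂ p₂ * S - rotY q p b * b₂ := rfl
  have hYr : rotY q p b = 2 * p * coheight q p * C + (2 * (q ^ 2 + p ^ 2) - 1) * S := rfl
  have hZr : rotZ q p b = (2 * (q ^ 2 + p ^ 2) - 1) * C - 2 * p * coheight q p * S := rfl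
  -- Rotating position and velocity together preserves the tangency relation. The contribution of
  -- the varying angle is left out here and enters in `eYZ`.
  have hradr₁ : X * X₁ + rotY q p b * (dualY q p q₁ p₁ * C + dualZ q p q₁ p₁ * S)
      + rotZ q p b * (dualZ q p q₁ p₁ * C - dualY q p q₁ p₁ * S) = 0 := by
    rw [hYr, hZr]
    linear_combination hrad₁ + (2 * p * coheight q p * dualY q p q₁ p₁
      + (2 * (q ^ 2 + p ^ 2) - 1) * dualZ q p q₁ p₁) * hb
  have hradr₂ : X * X₂ + rotY q p b * (dualY q p q₂ p₂ * C + dualZ q p q₂ p₂ * S)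
      + rotZ q p b * (dualZ q p q₂ p₂ * C - dualY q p q₂ p₂ * S) = 0 := by
    rw [hYr, hZr]
    linear_combination hrad₂ + (2 * p * coheight q p * dualY q p q₂ p₂
      + (2 * (q ^ 2 + p ^ 2) - 1) * dualZ q p q₂ p₂) * hb
  have eXY : X₁ * derivRotY q p b q₂ p₂ b₂ - derivRotY q p b q₁ p₁ b₁ * X₂
      = -4 * rotZ q p b * w + rotZ q p b * (X₁ * b₂ - b₁ * X₂) := by
    rw [hY₁, hY₂, hZr]
    linear_combination C * hXY - S * hZX
  have eZX : derivRotZ q p b q₁ p₁ b₁ * X₂ - X₁ * derivRotZ q p b q₂ p₂ b₂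
      = -4 * rotY q p b * w + rotY q p b * (X₁ * b₂ - b₁ * X₂) := by
    rw [hZ₁, hZ₂, hYr]
    linear_combination C * hZX + S * hXY
  have eYZ : derivRotY q p b q₁ p₁ b₁ * derivRotZ q p b q₂ p₂ b₂
      - derivRotZ q p b q₁ p₁ b₁ * derivRotY q p b q₂ p₂ b₂
      = -4 * X * w + X * (X₁ * b₂ - b₁ * X₂) := by
    rw [hY₁, hY₂, hZ₁, hZ₂]
    linear_combination hYZ * (S ^ 2 + C ^ 2) + (-4 * X * w) * hb - b₂ * hradr₁ + b₁ * hradr₂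
  generalize derivRotY q p b q₁ p₁ b₁ = Y₁ at *
  generalize derivRotY q p b q₂ p₂ b₂ = Y₂ at *
  generalize derivRotZ q p b q₁ p₁ b₁ = Z₁ at *
  generalize derivRotZ q p b q₂ p₂ b₂ = Z₂ at *
  generalize rotY q p b = Y at *
  generalize hZ : rotZ q p b = Z at *
  have hZ' : Z = 1 - s ^ 2 / 2 := by linarith
  have key : (X₁ / s + X * Z₁ / s ^ 3) * (Y₂ / s + Y * Z₂ / s ^ 3)
      - (Y₁ / s + Y * Z₁ / s ^ 3) * (X₂ / s + X * Z₂ / s ^ 3)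
      = ((X₁ * Y₂ - Y₁ * X₂) * s ^ 2 - Y * (Z₁ * X₂ - X₁ * Z₂) - X * (Y₁ * Z₂ - Z₁ * Y₂)) / s ^ 4 := by
    field_simp
    ring
  rw [key, eXY, eZX, eYZ, div_eq_iff (by positivity)]
  subst hZ'
  -- Since s² = 2(1 - Z), the sphere equation gives Z s² - X² - Y² = -(1 - Z)² = -s⁴ / 4, which
  -- cancels the denominator.
  linear_combination (4 * w - (X₁ * b₂ - b₁ * X₂)) * hsph

/-! ### Maps that move only the first two pairs of coordinates -/

/-- Replace the first two pairs of coordinates of `x` by `(a, b)` and `(c, d)`. -/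
def replacePairs {m : ℕ} (a b c d : ℝ) (x : PhaseSpace (m + 2)) : PhaseSpace (m + 2) :=
  WithLp.toLp 2 fun k =>
    Fin.cases (![a, b] k.2) (Fin.cases (![c, d] k.2) fun i => x (i.succ.succ, k.2)) k.1

section ReplacePairs

variable {m : ℕ}

@[simp] lemma replacePairs_q₁ (a b c d : ℝ) (x : PhaseSpace (m + 2)) :
    replacePairs a b c d x (0, 0) = a := rfl

@[simp] lemma replacePairs_p₁ (a b c d : ℝ) (x : PhaseSpace (m + 2)) :
    replacePairs a b c d x (0, 1) = b := rfl

@[simp] lemma replacePairs_q₂ (a b c d : ℝ) (x : PhaseSpace (m + 2)) :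
    replacePairs a b c d x (1, 0) = c := rfl

@[simp] lemma replacePairs_p₂ (a b c d : ℝ) (x : PhaseSpace (m + 2)) :
    replacePairs a b c d x (1, 1) = d := rfl

@[simp] lemma replacePairs_succ (a b c d : ℝ) (x : PhaseSpace (m + 2)) (i : Fin m) (j : Fin 2) :
    replacePairs a b c d x (i.succ.succ, j) = x (i.succ.succ, j) := rfl

lemma PhaseSpace.ext_pairs {x y : PhaseSpace (m + 2)} (h₁ : x (0, 0) = y (0, 0))
    (h₂ : x (0, 1) = y (0, 1)) (h₃ : x (1, 0) = y (1, 0)) (h₄ : x (1, 1) = y (1, 1))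
    (h : ∀ (i : Fin m) (j : Fin 2), x (i.succ.succ, j) = y (i.succ.succ, j)) : x = y := by
  ext ⟨i, j⟩
  refine Fin.cases ?_ (fun i => Fin.cases ?_ (fun i => h i j) i) i
  · fin_cases j
    exacts [h₁, h₂]
  · fin_cases j
    exacts [h₃, h₄]

lemma stdSymplecticForm_pairs (u v : PhaseSpace (m + 2)) :
    stdSymplecticForm u v = (u (0, 0) * v (0, 1) - u (0, 1) * v (0, 0))
      + ((u (1, 0) * v (1, 1) - u (1, 1) * v (1, 0))
      + ∑ i : Fin m, (u (i.succ.succ, 0) * v (i.succ.succ, 1)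
        - u (i.succ.succ, 1) * v (i.succ.succ, 0))) := by
  rw [stdSymplecticForm, Fin.sum_univ_succ, Fin.sum_univ_succ]
  rfl

lemma PhaseSpace.contDiff_apply {n : ℕ} (k : Fin n × Fin 2) :
    ContDiff ℝ ∞ (fun x : PhaseSpace n => x k) :=
  contDiff_euclidean.1 contDiff_id k

lemma contDiffOn_replacePairs {U : Set (PhaseSpace (m + 2))} {a b c d : PhaseSpace (m + 2) → ℝ}
    (ha : ContDiffOn ℝ ∞ a U) (hb : ContDiffOn ℝ ∞ b U) (hc : ContDiffOn ℝ ∞ c U)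
    (hd : ContDiffOn ℝ ∞ d U) :
    ContDiffOn ℝ ∞ (fun x => replacePairs (a x) (b x) (c x) (d x) x) U := by
  rw [contDiffOn_euclidean]
  rintro ⟨i, j⟩
  refine Fin.cases ?_ (fun i => Fin.cases ?_ (fun i => ?_) i) i
  · fin_cases j
    exacts [ha, hb]
  · fin_cases j
    exacts [hc, hd]
  · exact (PhaseSpace.contDiff_apply (i.succ.succ, j)).contDiffOn

/-- The derivative of a map in a coordinate is the derivative along a line. -/
lemma fderiv_apply_eq_of_hasDerivAt {n : ℕ} {ψ : PhaseSpace n → PhaseSpace n} {x u : PhaseSpace n}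
    (hψ : DifferentiableAt ℝ ψ x) {k : Fin n × Fin 2} {c : ℝ}
    (h : HasDerivAt (fun t : ℝ => ψ (x + t • u) k) c 0) : fderiv ℝ ψ x u k = c := by
  have h1 : HasDerivAt (fun t : ℝ => ψ (x + t • u)) (fderiv ℝ ψ x u) 0 :=
    hψ.hasFDerivAt.hasLineDerivAt u
  exact (((EuclideanSpace.proj (𝕜 := ℝ) k).hasFDerivAt.comp_hasDerivAt (0 : ℝ) h1).unique h)

lemma hasDerivAt_line {n : ℕ} (x u : PhaseSpace n) (k : Fin n × Fin 2) :
    HasDerivAt (fun t : ℝ => (x + t • u) k) (u k) 0 := by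
  have : HasDerivAt (fun t : ℝ => x k + t * u k) (u k) 0 := by
    simpa using ((hasDerivAt_id (0 : ℝ)).mul_const (u k)).const_add (x k)
  exact this

/-- A map of the first two pairs of coordinates is symplectic if it is so in these coordinates. -/
lemma stdSymplecticForm_fderiv_replacePairs {a b c d : PhaseSpace (m + 2) → ℝ}
    {x : PhaseSpace (m + 2)}
    (hψ : DifferentiableAt ℝ (fun x => replacePairs (a x) (b x) (c x) (d x) x) x)
    {a' b' c' d' : PhaseSpace (m + 2) → ℝ}
    (ha : ∀ u, HasDerivAt (fun t : ℝ => a (x + t • u)) (a' u) 0)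
    (hb : ∀ u, HasDerivAt (fun t : ℝ => b (x + t • u)) (b' u) 0)
    (hc : ∀ u, HasDerivAt (fun t : ℝ => c (x + t • u)) (c' u) 0)
    (hd : ∀ u, HasDerivAt (fun t : ℝ => d (x + t • u)) (d' u) 0)
    (h : ∀ u v, (a' u * b' v - b' u * a' v) + (c' u * d' v - d' u * c' v)
      = (u (0, 0) * v (0, 1) - u (0, 1) * v (0, 0))
        + (u (1, 0) * v (1, 1) - u (1, 1) * v (1, 0)))
    (u v : PhaseSpace (m + 2)) :
    stdSymplecticForm (fderiv ℝ (fun x => replacePairs (a x) (b x) (c x) (d x) x) x u)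
      (fderiv ℝ (fun x => replacePairs (a x) (b x) (c x) (d x) x) x v)
      = stdSymplecticForm u v := by
  have e₁ := fun u => fderiv_apply_eq_of_hasDerivAt hψ (u := u) (k := (0, 0)) (ha u)
  have e₂ := fun u => fderiv_apply_eq_of_hasDerivAt hψ (u := u) (k := (0, 1)) (hb u)
  have e₃ := fun u => fderiv_apply_eq_of_hasDerivAt hψ (u := u) (k := (1, 0)) (hc u)
  have e₄ := fun u => fderiv_apply_eq_of_hasDerivAt hψ (u := u) (k := (1, 1)) (hd u)
  have e := fun u (i : Fin m) (j : Fin 2) => fderiv_apply_eq_of_hasDerivAt hψ (u := u)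
    (k := (i.succ.succ, j)) (hasDerivAt_line x u (i.succ.succ, j))
  rw [stdSymplecticForm_pairs, stdSymplecticForm_pairs]
  simp only [e₁, e₂, e₃, e₄, e]
  linarith [h u v]

end ReplacePairs

/-! ### Symplectic embeddings -/

/-- A left inverse continuous on a set containing the image already gives the homeomorphism onto the
image, so openness of the image need not be shown. -/
lemma isSymplecticEmbeddingOn_of_leftInvOn {n : ℕ} {ψ φ : PhaseSpace n → PhaseSpace n}
    {U V : Set (PhaseSpace n)} (hU : IsOpen U) (hψ : ContDiffOn ℝ ∞ ψ U) (hm : MapsTo ψ U V)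
    (hφ : ContinuousOn φ V) (hi : LeftInvOn φ ψ U)
    (hs : ∀ x ∈ U, ∀ u v : PhaseSpace n,
      stdSymplecticForm (fderiv ℝ ψ x u) (fderiv ℝ ψ x v) = stdSymplecticForm u v) :
    IsSymplecticEmbeddingOn ψ U := by
  refine ⟨hU, hψ, ?_, hs⟩
  have h1 : Topology.IsEmbedding (fun x : U => (⟨ψ x, hm x.2⟩ : V)) := by
    refine Topology.IsEmbedding.of_comp (g := V.domRestrict φ)
      (hψ.continuousOn.domRestrict.subtype_mk _) hφ.domRestrict ?_
    have : V.domRestrict φ ∘ (fun x : U => (⟨ψ x, hm x.2⟩ : V)) = Subtype.val := by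
      ext1 x
      exact hi x.2
    rw [this]
    exact Topology.IsEmbedding.subtypeVal
  exact Topology.IsEmbedding.subtypeVal.comp h1

lemma IsSymplecticEmbeddingOn.comp {n : ℕ} {ψ φ : PhaseSpace n → PhaseSpace n}
    {U V : Set (PhaseSpace n)} (hφ : IsSymplecticEmbeddingOn φ V)
    (hψ : IsSymplecticEmbeddingOn ψ U) (hm : MapsTo ψ U V) :
    IsSymplecticEmbeddingOn (φ ∘ ψ) U := by
  refine ⟨hψ.isOpen, hφ.contDiffOn.comp hψ.contDiffOn hm, ?_, fun x hx u v => ?_⟩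
  · have h1 : Topology.IsEmbedding (fun x : U => (⟨ψ x, hm x.2⟩ : V)) :=
      Topology.IsEmbedding.of_comp (g := Subtype.val)
        (hψ.contDiffOn.continuousOn.domRestrict.subtype_mk _) continuous_subtype_val hψ.isEmbedding
    exact hφ.isEmbedding.comp h1
  · have d1 : DifferentiableAt ℝ ψ x :=
      (hψ.contDiffOn.contDiffAt (hψ.isOpen.mem_nhds hx)).differentiableAt (by simp)
    have d2 : DifferentiableAt ℝ φ (ψ x) :=
      (hφ.contDiffOn.contDiffAt (hφ.isOpen.mem_nhds (hm hx))).differentiableAt (by simp)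
    rw [fderiv_comp x d2 d1]
    simp only [ContinuousLinearMap.comp_apply]
    rw [hφ.symplectic _ (hm hx), hψ.symplectic _ hx]

lemma IsSymplecticEmbeddingOn.mono {n : ℕ} {ψ : PhaseSpace n → PhaseSpace n}
    {U V : Set (PhaseSpace n)} (hψ : IsSymplecticEmbeddingOn ψ V) (hU : IsOpen U) (h : U ⊆ V) :
    IsSymplecticEmbeddingOn ψ U :=
  ⟨hU, hψ.contDiffOn.mono h,
    hψ.isEmbedding.comp (Topology.IsEmbedding.inclusion h), fun x hx => hψ.symplectic x (h hx)⟩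

/-! ### Lifts along the flow of a function of `q u` -/

section SphereLift

variable {m : ℕ}

/-- The angle of rotation of the lift. -/
def liftAngle (g : ℝ → ℝ) (x : PhaseSpace (m + 2)) : ℝ :=
  2 * g (discHam (x (0, 0)) (x (0, 1))) * x (1, 1)

/-- The time one map of the Hamiltonian `f (q¹ u) p₂`, for `g = f'`. -/
def sphereLift (f g : ℝ → ℝ) (x : PhaseSpace (m + 2)) : PhaseSpace (m + 2) :=
  replacePairs (rotQ (x (0, 0)) (x (0, 1)) (liftAngle g x))
    (rotP (x (0, 0)) (x (0, 1)) (liftAngle g x))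
    (x (1, 0) + f (discHam (x (0, 0)) (x (0, 1)))) (x (1, 1)) x

/-- The domain of `sphereLift f g`. -/
def sphereLiftDomain (m : ℕ) (g : ℝ → ℝ) : Set (PhaseSpace (m + 2)) :=
  {x | x (0, 0) ^ 2 + x (0, 1) ^ 2 < 1 ∧ rotZ (x (0, 0)) (x (0, 1)) (liftAngle g x) < 1}

lemma contDiffOn_coheight : ContDiffOn ℝ ∞
    (fun x : PhaseSpace (m + 2) => coheight (x (0, 0)) (x (0, 1)))
    {x | x (0, 0) ^ 2 + x (0, 1) ^ 2 < 1} := by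
  have hq := PhaseSpace.contDiff_apply (n := m + 2) (0, 0)
  have hp := PhaseSpace.contDiff_apply (n := m + 2) (0, 1)
  refine ContDiffOn.sqrt ((contDiff_const.sub ((hq.pow 2).add (hp.pow 2))).contDiffOn) ?_
  intro x hx
  have : x (0, 0) ^ 2 + x (0, 1) ^ 2 < 1 := hx
  linarith

lemma contDiffOn_discHam : ContDiffOn ℝ ∞
    (fun x : PhaseSpace (m + 2) => discHam (x (0, 0)) (x (0, 1)))
    {x | x (0, 0) ^ 2 + x (0, 1) ^ 2 < 1} :=
  (PhaseSpace.contDiff_apply (n := m + 2) (0, 0)).contDiffOn.mul contDiffOn_coheight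

variable {f g : ℝ → ℝ}

lemma contDiffOn_liftAngle (hg : ContDiff ℝ ∞ g) : ContDiffOn ℝ ∞
    (liftAngle (m := m) g) {x | x (0, 0) ^ 2 + x (0, 1) ^ 2 < 1} :=
  (contDiffOn_const.mul (hg.comp_contDiffOn contDiffOn_discHam)).mul
    (PhaseSpace.contDiff_apply (n := m + 2) (1, 1)).contDiffOn

lemma contDiffOn_rotZ (hg : ContDiff ℝ ∞ g) : ContDiffOn ℝ ∞
    (fun x : PhaseSpace (m + 2) => rotZ (x (0, 0)) (x (0, 1)) (liftAngle g x))
    {x | x (0, 0) ^ 2 + x (0, 1) ^ 2 < 1} := by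
  have hq := PhaseSpace.contDiff_apply (n := m + 2) (0, 0)
  have hp := PhaseSpace.contDiff_apply (n := m + 2) (0, 1)
  exact (((contDiff_const.mul ((hq.pow 2).add (hp.pow 2))).sub contDiff_const).contDiffOn.mul
    (contDiffOn_liftAngle hg).cos).sub
    (((contDiff_const.mul hp).contDiffOn.mul contDiffOn_coheight).mul (contDiffOn_liftAngle hg).sin)

lemma contDiffOn_rotY (hg : ContDiff ℝ ∞ g) : ContDiffOn ℝ ∞
    (fun x : PhaseSpace (m + 2) => rotY (x (0, 0)) (x (0, 1)) (liftAngle g x))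
    {x | x (0, 0) ^ 2 + x (0, 1) ^ 2 < 1} := by
  have hq := PhaseSpace.contDiff_apply (n := m + 2) (0, 0)
  have hp := PhaseSpace.contDiff_apply (n := m + 2) (0, 1)
  exact (((contDiff_const.mul hp).contDiffOn.mul contDiffOn_coheight).mul
    (contDiffOn_liftAngle hg).cos).add
    (((contDiff_const.mul ((hq.pow 2).add (hp.pow 2))).sub contDiff_const).contDiffOn.mul
    (contDiffOn_liftAngle hg).sin)

lemma isOpen_cylinder :
    IsOpen {x : PhaseSpace (m + 2) | x (0, 0) ^ 2 + x (0, 1) ^ 2 < 1} := by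
  have hq := (PhaseSpace.contDiff_apply (n := m + 2) (0, 0)).continuous
  have hp := (PhaseSpace.contDiff_apply (n := m + 2) (0, 1)).continuous
  exact isOpen_lt ((hq.pow 2).add (hp.pow 2)) continuous_const

lemma isOpen_sphereLiftDomain (hg : ContDiff ℝ ∞ g) : IsOpen (sphereLiftDomain m g) :=
  (contDiffOn_rotZ hg).continuousOn.isOpen_inter_preimage isOpen_cylinder isOpen_Iio

lemma contDiffOn_sphereLift (hf : ContDiff ℝ ∞ f) (hg : ContDiff ℝ ∞ g) :
    ContDiffOn ℝ ∞ (sphereLift (m := m) f g) (sphereLiftDomain m g) := by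
  have hsub : sphereLiftDomain m g ⊆ {x | x (0, 0) ^ 2 + x (0, 1) ^ 2 < 1} := fun x hx => hx.1
  have hD : ContDiffOn ℝ ∞ (fun x : PhaseSpace (m + 2) =>
      √(2 * (1 - rotZ (x (0, 0)) (x (0, 1)) (liftAngle g x)))) (sphereLiftDomain m g) := by
    refine (contDiffOn_const.mul (contDiffOn_const.sub ((contDiffOn_rotZ hg).mono hsub))).sqrt ?_
    intro x hx
    have := hx.2
    linarith
  have hD0 : ∀ x ∈ sphereLiftDomain m g,
      √(2 * (1 - rotZ (x (0, 0)) (x (0, 1)) (liftAngle g x))) ≠ 0 := by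
    intro x hx
    have := hx.2
    exact (Real.sqrt_pos.2 (by linarith)).ne'
  refine contDiffOn_replacePairs ?_ ?_ ?_ ?_
  · exact (contDiffOn_const.mul (contDiffOn_discHam.mono hsub)).div hD hD0
  · exact ((contDiffOn_rotY hg).mono hsub).div hD hD0
  · exact (PhaseSpace.contDiff_apply (1, 0)).contDiffOn.add
      (hf.comp_contDiffOn (contDiffOn_discHam.mono hsub))
  · exact (PhaseSpace.contDiff_apply (1, 1)).contDiffOn

/-- Both H and p₂ are constant along the flow, so the map for -g turns every image point back by the
angle it was turned. -/
lemma liftAngle_neg_sphereLift {x : PhaseSpace (m + 2)} (hx : x ∈ sphereLiftDomain m g) :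
    liftAngle (-g) (sphereLift f g x) = -liftAngle g x := by
  rw [liftAngle]
  simp only [sphereLift, replacePairs_q₁, replacePairs_p₁, replacePairs_p₂]
  rw [discHam_rot hx.1 hx.2]
  simp [liftAngle]

lemma sphereLift_mapsTo :
    MapsTo (sphereLift (m := m) f g) (sphereLiftDomain m g) (sphereLiftDomain m (-g)) := by
  intro x hx
  refine ⟨?_, ?_⟩
  · simpa [sphereLift] using rot_norm_lt hx.1 hx.2
  · rw [liftAngle_neg_sphereLift hx]
    simp only [sphereLift, replacePairs_q₁, replacePairs_p₁]
    rw [rotZ_rot_neg hx.1 hx.2]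
    linarith [hx.1]

lemma sphereLift_neg_leftInvOn :
    LeftInvOn (sphereLift (m := m) (-f) (-g)) (sphereLift f g) (sphereLiftDomain m g) := by
  intro x hx
  rw [sphereLift, liftAngle_neg_sphereLift hx]
  apply PhaseSpace.ext_pairs
  · simp [sphereLift, rotQ_rot_neg hx.1 hx.2]
  · simp [sphereLift, rotP_rot_neg hx.1 hx.2]
  · simp [sphereLift, discHam_rot hx.1 hx.2]
  · simp [sphereLift]
  · intro i j
    simp [sphereLift]

lemma hasDerivAt_discHam_line {x : PhaseSpace (m + 2)}
    (hx : x (0, 0) ^ 2 + x (0, 1) ^ 2 < 1) (u : PhaseSpace (m + 2)) :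
    HasDerivAt (fun t : ℝ => discHam ((x + t • u) (0, 0)) ((x + t • u) (0, 1)))
      (dualX (x (0, 0)) (x (0, 1)) (u (0, 0)) (u (0, 1)) / 2) 0 := by
  have := HasDerivAt.discHam (t := 0) (by simpa using hx) (hasDerivAt_line x u (0, 0))
    (hasDerivAt_line x u (0, 1))
  refine this.congr_deriv ?_
  simp [dualX]

/-- With b = 2 g(H) p₂ and X = 2H, the term dX ∧ db / 4 in `derivRot_wedge` equals g(H) dH ∧ dp₂,
because dH ∧ dH = 0. The shift of q₂ by f(H) adds exactly this term back. -/
lemma sphereLift_symplectic (hf : ContDiff ℝ ∞ f) (hg : ContDiff ℝ ∞ g)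
    (hfg : ∀ t, HasDerivAt f (g t) t) {x : PhaseSpace (m + 2)} (hx : x ∈ sphereLiftDomain m g)
    (u v : PhaseSpace (m + 2)) :
    stdSymplecticForm (fderiv ℝ (sphereLift f g) x u) (fderiv ℝ (sphereLift f g) x v)
      = stdSymplecticForm u v := by
  have hd : DifferentiableAt ℝ (sphereLift f g) x :=
    ((contDiffOn_sphereLift hf hg).contDiffAt
      ((isOpen_sphereLiftDomain hg).mem_nhds hx)).differentiableAt (by simp)
  set H := discHam (x (0, 0)) (x (0, 1)) with hH
  have hg' : HasDerivAt g (deriv g H) H := (hg.differentiable (by simp) H).hasDerivAt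
  set b' : PhaseSpace (m + 2) → ℝ := fun u =>
    2 * (deriv g H * (dualX (x (0, 0)) (x (0, 1)) (u (0, 0)) (u (0, 1)) / 2)) * x (1, 1)
      + 2 * g H * u (1, 1) with hb'
  have hb : ∀ u, HasDerivAt (fun t : ℝ => liftAngle g (x + t • u)) (b' u) 0 := by
    intro u
    have h1 := HasDerivAt.comp (h₂ := g) (0 : ℝ) (by simpa only [zero_smul, add_zero] using hg')
      (hasDerivAt_discHam_line hx.1 u)
    refine ((h1.const_mul 2).mul (hasDerivAt_line x u (1, 1))).congr_deriv ?_
    simp [hb', hH]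
  have hrot := fun u => hasDerivAt_rotQ_rotP (t := 0) (by simpa using hx.1) (by simpa using hx.2)
    (hasDerivAt_line x u (0, 0)) (hasDerivAt_line x u (0, 1)) (hb u)
  refine stdSymplecticForm_fderiv_replacePairs (x := x) hd (fun u => (hrot u).1)
    (fun u => (hrot u).2) (fun u => (hasDerivAt_line x u (1, 0)).add
      (HasDerivAt.comp (h₂ := f) (0 : ℝ) (by simpa only [zero_smul, add_zero] using hfg H) (hasDerivAt_discHam_line hx.1 u)))
    (fun u => hasDerivAt_line x u (1, 1)) ?_ u v
  intro u v
  simp only [zero_smul, add_zero]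
  rw [derivRot_wedge hx.1 hx.2]
  simp only [hb']
  ring

lemma isSymplecticEmbeddingOn_sphereLift (hf : ContDiff ℝ ∞ f) (hg : ContDiff ℝ ∞ g)
    (hfg : ∀ t, HasDerivAt f (g t) t) :
    IsSymplecticEmbeddingOn (sphereLift (m := m) f g) (sphereLiftDomain m g) :=
  isSymplecticEmbeddingOn_of_leftInvOn (isOpen_sphereLiftDomain hg) (contDiffOn_sphereLift hf hg)
    sphereLift_mapsTo (contDiffOn_sphereLift (f := -f) hf.neg hg.neg).continuousOn
    sphereLift_neg_leftInvOn (fun _ hx => sphereLift_symplectic hf hg hfg hx)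

end SphereLift

/-! ### Lifts along radial rotations -/

section RadialLift

variable {m : ℕ}

/-- The time one map of the Hamiltonian `-k (q² + p²) q²`, for `l = k'`. -/
def radialLift (k l : ℝ → ℝ) (x : PhaseSpace (m + 2)) : PhaseSpace (m + 2) :=
  let b := 2 * l (x (0, 0) ^ 2 + x (0, 1) ^ 2) * x (1, 0)
  replacePairs (x (0, 0) * Real.cos b - x (0, 1) * Real.sin b)
    (x (0, 0) * Real.sin b + x (0, 1) * Real.cos b)
    (x (1, 0)) (x (1, 1) + k (x (0, 0) ^ 2 + x (0, 1) ^ 2)) x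

variable {k l : ℝ → ℝ}

lemma radialLift_norm_sq (x : PhaseSpace (m + 2)) :
    radialLift k l x (0, 0) ^ 2 + radialLift k l x (0, 1) ^ 2 = x (0, 0) ^ 2 + x (0, 1) ^ 2 := by
  simp only [radialLift, replacePairs_q₁, replacePairs_p₁]
  linear_combination (x (0, 0) ^ 2 + x (0, 1) ^ 2) *
    Real.sin_sq_add_cos_sq (2 * l (x (0, 0) ^ 2 + x (0, 1) ^ 2) * x (1, 0))

lemma contDiff_radialLift (hk : ContDiff ℝ ∞ k) (hl : ContDiff ℝ ∞ l) :
    ContDiff ℝ ∞ (radialLift (m := m) k l) := by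
  have h := PhaseSpace.contDiff_apply (n := m + 2)
  have hr := ((h (0, 0)).pow 2).add ((h (0, 1)).pow 2)
  have hb := (contDiff_const (c := (2 : ℝ))).mul (hl.comp hr) |>.mul (h (1, 0))
  rw [← contDiffOn_univ]
  refine contDiffOn_replacePairs ?_ ?_ ?_ ?_ <;> rw [contDiffOn_univ]
  · exact ((h (0, 0)).mul hb.cos).sub ((h (0, 1)).mul hb.sin)
  · exact ((h (0, 0)).mul hb.sin).add ((h (0, 1)).mul hb.cos)
  · exact h (1, 0)
  · exact (h (1, 1)).add (hk.comp hr)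

lemma radialLift_neg_leftInverse :
    Function.LeftInverse (radialLift (m := m) (-k) (-l)) (radialLift k l) := by
  intro x
  have hb := Real.sin_sq_add_cos_sq (2 * l (x (0, 0) ^ 2 + x (0, 1) ^ 2) * x (1, 0))
  have hq : radialLift k l x (1, 0) = x (1, 0) := rfl
  have e : 2 * (-l) (x (0, 0) ^ 2 + x (0, 1) ^ 2) * x (1, 0)
    = -(2 * l (x (0, 0) ^ 2 + x (0, 1) ^ 2) * x (1, 0)) := by simp
  apply PhaseSpace.ext_pairs
  · rw [radialLift]
    simp only [replacePairs_q₁]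
    rw [radialLift_norm_sq, hq, e, Real.cos_neg, Real.sin_neg]
    simp only [radialLift, replacePairs_q₁, replacePairs_p₁]
    linear_combination x (0, 0) * hb
  · rw [radialLift]
    simp only [replacePairs_p₁]
    rw [radialLift_norm_sq, hq, e, Real.cos_neg, Real.sin_neg]
    simp only [radialLift, replacePairs_q₁, replacePairs_p₁]
    linear_combination x (0, 1) * hb
  · rfl
  · rw [radialLift]
    simp only [replacePairs_p₂]
    rw [radialLift_norm_sq]
    simp [radialLift]
  · intro i j
    rfl

/-- Turning by b adds d(r²) ∧ db / 2 = l dr² ∧ dq₂ to the area form of the disc. The shift of p₂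
adds l dq₂ ∧ dr², and the two cancel. -/
lemma radialLift_symplectic (hk : ContDiff ℝ ∞ k) (hl : ContDiff ℝ ∞ l)
    (hkl : ∀ t, HasDerivAt k (l t) t) (x u v : PhaseSpace (m + 2)) :
    stdSymplecticForm (fderiv ℝ (radialLift k l) x u) (fderiv ℝ (radialLift k l) x v)
      = stdSymplecticForm u v := by
  have hd : DifferentiableAt ℝ (radialLift k l) x :=
    (contDiff_radialLift hk hl).contDiffAt.differentiableAt (by simp)
  set r := x (0, 0) ^ 2 + x (0, 1) ^ 2 with hr
  set r' : PhaseSpace (m + 2) → ℝ := fun u =>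
    2 * x (0, 0) * u (0, 0) + 2 * x (0, 1) * u (0, 1) with hr'
  have hR : ∀ u, HasDerivAt (fun t : ℝ => (x + t • u) (0, 0) ^ 2 + (x + t • u) (0, 1) ^ 2)
      (r' u) 0 := by
    intro u
    refine (((hasDerivAt_line x u (0, 0)).pow 2).add
      ((hasDerivAt_line x u (0, 1)).pow 2)).congr_deriv ?_
    simp [hr']
  have hl' : HasDerivAt l (deriv l r) r := (hl.differentiable (by simp) r).hasDerivAt
  set b' : PhaseSpace (m + 2) → ℝ := fun u =>
    2 * (deriv l r * r' u) * x (1, 0) + 2 * l r * u (1, 0) with hb'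
  have hb : ∀ u, HasDerivAt (fun t : ℝ => 2 * l ((x + t • u) (0, 0) ^ 2 + (x + t • u) (0, 1) ^ 2)
      * (x + t • u) (1, 0)) (b' u) 0 := by
    intro u
    have h1 := HasDerivAt.comp (h₂ := l) (0 : ℝ) (by simpa only [zero_smul, add_zero] using hl') (hR u)
    refine ((h1.const_mul 2).mul (hasDerivAt_line x u (1, 0))).congr_deriv ?_
    simp [hb', hr]
  refine stdSymplecticForm_fderiv_replacePairs (x := x) hd
    (fun u => ((hasDerivAt_line x u (0, 0)).mul (hb u).cos).sub
      ((hasDerivAt_line x u (0, 1)).mul (hb u).sin))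
    (fun u => ((hasDerivAt_line x u (0, 0)).mul (hb u).sin).add
      ((hasDerivAt_line x u (0, 1)).mul (hb u).cos))
    (fun u => hasDerivAt_line x u (1, 0)) (fun u => (hasDerivAt_line x u (1, 1)).add
      (HasDerivAt.comp (h₂ := k) (0 : ℝ) (by simpa only [zero_smul, add_zero] using hkl r) (hR u))) ?_ u v
  intro u v
  simp only [zero_smul, add_zero]
  rw [← hr]
  have hsc := Real.sin_sq_add_cos_sq (2 * l r * x (1, 0))
  generalize Real.sin (2 * l r * x (1, 0)) = S at *
  generalize Real.cos (2 * l r * x (1, 0)) = C at *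
  have : b' u * r' v - r' u * b' v = 2 * l r * (u (1, 0) * r' v - r' u * v (1, 0)) := by
    simp only [hb']; ring
  have h2 : ∀ u v, r' u * b' v / 2 = (x (0, 0) * u (0, 0) + x (0, 1) * u (0, 1)) * b' v := by
    intro u v
    simp only [hr']; ring
  linear_combination (u (0, 0) * v (0, 1) - u (0, 1) * v (0, 0)
    + (x (0, 0) * u (0, 0) + x (0, 1) * u (0, 1)) * b' v
    - (x (0, 0) * v (0, 0) + x (0, 1) * v (0, 1)) * b' u) * hsc - this / 2 - h2 u v + h2 v u

lemma isSymplecticEmbeddingOn_radialLift (hk : ContDiff ℝ ∞ k) (hl : ContDiff ℝ ∞ l)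
    (hkl : ∀ t, HasDerivAt k (l t) t) :
    IsSymplecticEmbeddingOn (radialLift (m := m) k l) univ :=
  isSymplecticEmbeddingOn_of_leftInvOn isOpen_univ (contDiff_radialLift hk hl).contDiffOn
    (mapsTo_univ _ _) (contDiff_radialLift (k := -k) hk.neg hl.neg).continuous.continuousOn
    (fun x _ => radialLift_neg_leftInverse x) (fun x _ => radialLift_symplectic hk hl hkl x)

end RadialLift

/-! ### Twists of the plane -/

/-- The rotation of the disc with angle depending on `q u`, extended by the identity. -/
def diskTwist (g : ℝ → ℝ) (s : ℝ) (y : Plane) : Plane :=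
  open Classical in
  if y 0 ^ 2 + y 1 ^ 2 < 1 then
    !₂[rotQ (y 0) (y 1) (2 * g (discHam (y 0) (y 1)) * s),
      rotP (y 0) (y 1) (2 * g (discHam (y 0) (y 1)) * s)]
  else y

section DiskTwist

variable {g : ℝ → ℝ} {s : ℝ}

lemma diskTwist_of_lt {y : Plane} (h : y 0 ^ 2 + y 1 ^ 2 < 1) : diskTwist g s y =
    !₂[rotQ (y 0) (y 1) (2 * g (discHam (y 0) (y 1)) * s),
      rotP (y 0) (y 1) (2 * g (discHam (y 0) (y 1)) * s)] := if_pos h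

lemma diskTwist_of_not_lt {y : Plane} (h : ¬ y 0 ^ 2 + y 1 ^ 2 < 1) : diskTwist g s y = y :=
  if_neg h

/-- Only the great circle q = 0 could run into the missing point, and it stays fixed when g vanishes
at 0. The rotation is then defined on the whole disc. -/
lemma rotZ_lt_one_of_apply_zero (hg : g 0 = 0) {q p : ℝ} (h : q ^ 2 + p ^ 2 < 1) :
    rotZ q p (2 * g (discHam q p) * s) < 1 := by
  refine rotZ_lt_one h fun h0 => ?_
  rw [h0, hg, mul_zero, zero_mul, rotZ_zero]
  linarith

lemma diskTwist_neg_diskTwist (hg : g 0 = 0) (s : ℝ) (y : Plane) :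
    diskTwist g (-s) (diskTwist g s y) = y := by
  by_cases h : y 0 ^ 2 + y 1 ^ 2 < 1
  · have hz := rotZ_lt_one_of_apply_zero (s := s) hg h
    have hlt : (diskTwist g s y) 0 ^ 2 + (diskTwist g s y) 1 ^ 2 < 1 := by
      rw [diskTwist_of_lt h]
      exact rot_norm_lt h hz
    rw [diskTwist_of_lt hlt, diskTwist_of_lt h]
    have e := discHam_rot h hz
    have eQ := rotQ_rot_neg h hz
    have eP := rotP_rot_neg h hz
    ext i
    fin_cases i
    · simp [e, eQ]
    · simp [e, eP]
  · rw [diskTwist_of_not_lt (y := y) h, diskTwist_of_not_lt h]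

lemma diskTwist_injective (hg : g 0 = 0) (s : ℝ) : Function.Injective (diskTwist g s) :=
  Function.LeftInverse.injective (diskTwist_neg_diskTwist hg s)

lemma diskTwist_diskTwist_neg (hg : g 0 = 0) (s : ℝ) (y : Plane) :
    diskTwist g s (diskTwist g (-s) y) = y := by
  simpa using diskTwist_neg_diskTwist hg (-s) y

/-- The plane with constant second pair of coordinates `(0, s)`. -/
def planeSlice (s : ℝ) (y : Plane) : PhaseSpace (0 + 2) :=
  replacePairs (y 0) (y 1) 0 s 0

lemma contDiff_planeSlice (s : ℝ) : ContDiff ℝ ∞ (planeSlice s) := by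
  have h : ∀ i : Fin 2, ContDiff ℝ ∞ (fun y : Plane => y i) :=
    fun i => contDiff_euclidean.1 contDiff_id i
  rw [contDiff_euclidean]
  rintro ⟨i, j⟩
  fin_cases i <;> fin_cases j
  · exact h 0
  · exact h 1
  · exact contDiff_const
  · exact contDiff_const

/-- On the disc the twist is the first pair of a `sphereLift` restricted to a plane slice, so it
inherits smoothness. -/
lemma contDiffOn_diskTwist (hgs : ContDiff ℝ ∞ g) (hg : g 0 = 0) :
    ContDiffOn ℝ ∞ (diskTwist g s) {y | y 0 ^ 2 + y 1 ^ 2 < 1} := by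
  have h1 : ContDiffOn ℝ ∞ (fun y => sphereLift (fun _ => 0) g (planeSlice s y))
      {y | y 0 ^ 2 + y 1 ^ 2 < 1} :=
    (contDiffOn_sphereLift contDiff_const hgs).comp (contDiff_planeSlice s).contDiffOn
      fun y hy => ⟨hy, rotZ_lt_one_of_apply_zero hg hy⟩
  rw [contDiffOn_euclidean] at h1 ⊢
  intro i
  refine (h1 (0, i)).congr fun y hy => ?_
  rw [diskTwist_of_lt hy]
  fin_cases i <;> rfl

lemma isOpen_unitDisk : IsOpen {y : Plane | y 0 ^ 2 + y 1 ^ 2 < 1} := by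
  refine isOpen_lt ?_ continuous_const
  fun_prop

/-- Near the circle |H| ≤ u < η, where g vanishes. This makes the extension by the identity
continuous. -/
lemma diskTwist_eq_self {η : ℝ} (hη : ∀ t, |t| < η → g t = 0) {y : Plane}
    (hy : y 0 ^ 2 + y 1 ^ 2 < 1) (h : 1 - η ^ 2 < y 0 ^ 2 + y 1 ^ 2) (h0 : 0 < η) :
    diskTwist g s y = y := by
  have hu := coheight_sq hy
  have hu0 := coheight_pos hy
  have hlt : coheight (y 0) (y 1) < η := by nlinarith
  have hq : |y 0| ≤ 1 := by
    rw [abs_le_one_iff_mul_self_le_one]; nlinarith [sq_nonneg (y 1)]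
  have hH : |discHam (y 0) (y 1)| < η := by
    rw [discHam, abs_mul, abs_of_pos hu0]
    nlinarith [abs_nonneg (y 0)]
  rw [diskTwist_of_lt hy, hη _ hH, mul_zero, zero_mul, rotQ_zero hy, rotP_zero hy]
  ext i
  fin_cases i <;> rfl

lemma continuous_diskTwist (hgs : ContDiff ℝ ∞ g) {η : ℝ} (h0 : 0 < η)
    (hη : ∀ t, |t| < η → g t = 0) : Continuous (diskTwist g s) := by
  rw [continuous_iff_continuousAt]
  intro y
  by_cases h : y 0 ^ 2 + y 1 ^ 2 < 1
  · exact (contDiffOn_diskTwist hgs (hη 0 (by simpa))).continuousOn.continuousAt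
      (isOpen_unitDisk.mem_nhds h)
  · have hopen : IsOpen {y : Plane | 1 - η ^ 2 < y 0 ^ 2 + y 1 ^ 2} := by
      refine isOpen_lt continuous_const ?_
      fun_prop
    have hmem : y ∈ {y : Plane | 1 - η ^ 2 < y 0 ^ 2 + y 1 ^ 2} := by
      have := pow_pos h0 2
      rw [mem_ofPred_eq]
      linarith
    refine continuousAt_id.congr ?_
    filter_upwards [hopen.mem_nhds hmem] with x hx
    by_cases hx1 : x 0 ^ 2 + x 1 ^ 2 < 1
    · exact (diskTwist_eq_self hη hx1 hx h0).symm
    · exact (diskTwist_of_not_lt hx1).symm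

/-- For constant s the differential of the angle is a multiple of dX, so the correction term in
`derivRot_wedge` vanishes. -/
lemma det_fderiv_diskTwist (hgs : ContDiff ℝ ∞ g) (hg : g 0 = 0) {y : Plane}
    (hy : y 0 ^ 2 + y 1 ^ 2 < 1) : (fderiv ℝ (diskTwist g s) y).det = 1 := by
  have hd : DifferentiableAt ℝ (diskTwist g s) y :=
    ((contDiffOn_diskTwist hgs hg).contDiffAt (isOpen_unitDisk.mem_nhds hy)).differentiableAt
      (by simp)
  have hline : ∀ (v : Plane) (i : Fin 2), HasDerivAt (fun t : ℝ => (y + t • v) i) (v i) 0 := by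
    intro v i
    have : HasDerivAt (fun t : ℝ => y i + t * v i) (v i) 0 := by
      simpa using ((hasDerivAt_id (0 : ℝ)).mul_const (v i)).const_add (y i)
    exact this
  set H := discHam (y 0) (y 1) with hH
  have hg' : HasDerivAt g (deriv g H) H := (hgs.differentiable (by simp) H).hasDerivAt
  set b' : Plane → ℝ := fun v => 2 * (deriv g H * (dualX (y 0) (y 1) (v 0) (v 1) / 2)) * s
    with hb'
  have hb : ∀ v : Plane, HasDerivAt (fun t : ℝ =>
      2 * g (discHam ((y + t • v) 0) ((y + t • v) 1)) * s) (b' v) 0 := by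
    intro v
    have h1 := HasDerivAt.discHam (t := 0) (by simpa using hy) (hline v 0) (hline v 1)
    have h2 := HasDerivAt.comp (h₂ := g) (0 : ℝ)
      (by simpa only [zero_smul, add_zero] using hg') h1
    refine ((h2.const_mul 2).mul_const s).congr_deriv ?_
    simp only [zero_smul, add_zero, hb', dualX]
    ring
  have hrot := fun v : Plane => hasDerivAt_rotQ_rotP (t := 0) (by simpa using hy)
    (by simpa using rotZ_lt_one_of_apply_zero hg hy) (hline v 0) (hline v 1) (hb v)
  have hnear : ∀ v : Plane, ∀ᶠ t : ℝ in nhds 0, (y + t • v) 0 ^ 2 + (y + t • v) 1 ^ 2 < 1 := by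
    intro v
    have hc : Continuous fun t : ℝ => y + t • v := by fun_prop
    exact hc.continuousAt.eventually (isOpen_unitDisk.mem_nhds (by simpa using hy))
  have e : ∀ (v : Plane) (i : Fin 2) (c : ℝ),
      HasDerivAt (fun t : ℝ => diskTwist g s (y + t • v) i) c 0 →
      fderiv ℝ (diskTwist g s) y v i = c := by
    intro v i c hc
    have h1 : HasDerivAt (fun t : ℝ => diskTwist g s (y + t • v)) (fderiv ℝ (diskTwist g s) y v) 0 :=
      hd.hasFDerivAt.hasLineDerivAt v
    exact ((EuclideanSpace.proj (𝕜 := ℝ) i).hasFDerivAt.comp_hasDerivAt (0 : ℝ) h1).unique hc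
  have e₀ := fun v => e v 0 _ ((hrot v).1.congr_of_eventuallyEq (by
    filter_upwards [hnear v] with t ht
    rw [diskTwist_of_lt ht]; rfl))
  have e₁ := fun v => e v 1 _ ((hrot v).2.congr_of_eventuallyEq (by
    filter_upwards [hnear v] with t ht
    rw [diskTwist_of_lt ht]; rfl))
  rw [ContinuousLinearMap.det,
    ← LinearMap.det_toMatrix (EuclideanSpace.basisFun (Fin 2) ℝ).toBasis, Matrix.det_fin_two]
  simp only [LinearMap.toMatrix_apply, OrthonormalBasis.coe_toBasis, EuclideanSpace.basisFun_apply,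
    OrthonormalBasis.coe_toBasis_repr_apply, EuclideanSpace.basisFun_repr,
    ContinuousLinearMap.coe_coe, e₀, e₁, zero_smul, add_zero]
  rw [mul_comm (derivRotQ _ _ _ _ _ (b' (EuclideanSpace.single 1 1)))]
  rw [derivRot_wedge hy (rotZ_lt_one_of_apply_zero hg hy)]
  simp [hb']
  ring

lemma volume_diskTwist_image_le (hgs : ContDiff ℝ ∞ g) (hg : g 0 = 0) {T : Set Plane}
    (hT : MeasurableSet T) (h : ∀ y ∈ T, y 0 ^ 2 + y 1 ^ 2 < 1) :
    volume (diskTwist g s '' T) ≤ volume T := by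
  refine (addHaar_image_le_lintegral_abs_det_fderiv (f' := fderiv ℝ (diskTwist g s)) volume hT
    fun y hy => ?_).trans ?_
  · exact ((contDiffOn_diskTwist hgs hg).contDiffAt
      (isOpen_unitDisk.mem_nhds (h y hy))).differentiableAt (by simp) |>.hasFDerivAt.hasFDerivWithinAt
  · rw [setLIntegral_congr_fun (g := fun _ => 1) hT (fun y hy => by
      simp [det_fderiv_diskTwist hgs hg (h y hy)])]
    simp

end DiskTwist

/-! ### Bounded hulls and areas -/

/-- A connected set missing S lies in one component of the complement. If it is unbounded, so is
that component, and its points stay outside the hull. -/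
lemma boundedHull_subset {X : Type*} [PseudoMetricSpace X] {S T : Set X} (hST : S ⊆ T)
    (h : ∀ x ∉ T, ∃ K, IsPreconnected K ∧ x ∈ K ∧ K ⊆ Sᶜ ∧ ¬ Bornology.IsBounded K) :
    boundedHull S ⊆ T := by
  rintro x (hx | ⟨C, ⟨⟨c, -, rfl⟩, hb⟩, hx⟩)
  · exact hST hx
  · by_contra hxT
    obtain ⟨K, hK, hxK, hKS, hKb⟩ := h x hxT
    refine hKb (hb.subset ?_)
    rw [connectedComponentIn_eq hx]
    exact hK.subset_connectedComponentIn hxK hKS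

lemma plane_norm_sq (y : Plane) : ‖y‖ ^ 2 = y 0 ^ 2 + y 1 ^ 2 := by
  rw [EuclideanSpace.norm_sq_eq, Fin.sum_univ_two]
  simp

lemma volume_ball_sqrt (r : ℝ) :
    volume (Metric.ball (0 : Plane) (√r)) = ENNReal.ofReal (Real.pi * max r 0) := by
  rw [EuclideanSpace.volume_ball_fin_two, ← ENNReal.ofReal_pow (Real.sqrt_nonneg _),
    ← ENNReal.ofReal_mul (by positivity), mul_comm]
  congr 2
  rcases le_total 0 r with h | h
  · rw [Real.sq_sqrt h, max_eq_left h]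
  · rw [Real.sqrt_eq_zero_of_nonpos h, max_eq_right h]; simp

/-- Negative α is allowed, so that full discs are covered as well. -/
lemma volume_annulus_le (α β : ℝ) :
    volume {y : Plane | α < y 0 ^ 2 + y 1 ^ 2 ∧ y 0 ^ 2 + y 1 ^ 2 < β}
      ≤ ENNReal.ofReal (Real.pi * (β - α)) := by
  rcases le_or_gt β α with h | h
  · have : {y : Plane | α < y 0 ^ 2 + y 1 ^ 2 ∧ y 0 ^ 2 + y 1 ^ 2 < β} = ∅ := by
      ext y
      simp only [mem_ofPred_eq, mem_empty_iff_false, iff_false, not_and, not_lt]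
      intro h1
      linarith
    simp [this]
  rcases le_or_gt β 0 with h0 | h0
  · have : {y : Plane | α < y 0 ^ 2 + y 1 ^ 2 ∧ y 0 ^ 2 + y 1 ^ 2 < β} = ∅ := by
      ext y
      simp only [mem_ofPred_eq, mem_empty_iff_false, iff_false, not_and, not_lt]
      intro _
      nlinarith [sq_nonneg (y 0), sq_nonneg (y 1)]
    simp [this]
  have hsub : {y : Plane | α < y 0 ^ 2 + y 1 ^ 2 ∧ y 0 ^ 2 + y 1 ^ 2 < β}
      ⊆ Metric.ball 0 (√β) \ Metric.ball 0 (√α) := by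
    rintro y ⟨h1, h2⟩
    rw [← plane_norm_sq] at h1 h2
    refine ⟨?_, ?_⟩
    · rw [mem_ball_zero_iff]
      exact Real.lt_sqrt_of_sq_lt h2
    · rw [mem_ball_zero_iff, not_lt]
      exact Real.sqrt_le_iff.2 ⟨norm_nonneg _, h1.le⟩
  refine (measure_mono hsub).trans ?_
  rw [measure_sdiff (Metric.ball_subset_ball (Real.sqrt_le_sqrt h.le))
    measurableSet_ball.nullMeasurableSet (by rw [volume_ball_sqrt]; exact ENNReal.ofReal_ne_top),
    volume_ball_sqrt, volume_ball_sqrt, ← ENNReal.ofReal_sub _ (by positivity)]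
  refine ENNReal.ofReal_le_ofReal ?_
  rw [← mul_sub, max_eq_left h0.le]
  exact mul_le_mul_of_nonneg_left (by linarith [le_max_left α 0]) Real.pi_pos.le

/-! ### The profiles of the lifts -/

/-- An odd function that vanishes on `[-η, η]` and is `2` on `[2 η, ∞)`. -/
def stepProfile (η t : ℝ) : ℝ :=
  2 * (Real.smoothTransition ((t - η) / η) - Real.smoothTransition ((-t - η) / η))

/-- A function that vanishes on `[1 - δ, ∞)` and is linear of slope `-1 / δ` on
`(-∞, 1 - 2 δ]`. -/
def hillProfile (δ r : ℝ) : ℝ :=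
  (1 - δ - r) / δ * Real.smoothTransition ((1 - δ - r) / δ)

section Profiles

variable {η δ t r : ℝ}

lemma contDiff_stepProfile : ContDiff ℝ ∞ (stepProfile η) := by
  have h : ContDiff ℝ ∞ Real.smoothTransition := Real.smoothTransition.contDiff
  unfold stepProfile
  refine contDiff_const.mul (ContDiff.sub (h.comp ?_) (h.comp ?_)) <;> fun_prop

lemma stepProfile_neg : stepProfile η (-t) = -stepProfile η t := by
  unfold stepProfile
  rw [neg_neg]
  ring

lemma stepProfile_nonneg (hη : 0 < η) (ht : 0 ≤ t) : 0 ≤ stepProfile η t := by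
  unfold stepProfile
  rw [Real.smoothTransition.zero_of_nonpos (x := (-t - η) / η)
    (div_nonpos_of_nonpos_of_nonneg (by linarith) hη.le), sub_zero]
  have := Real.smoothTransition.nonneg ((t - η) / η)
  positivity

lemma stepProfile_eq_two (hη : 0 < η) (ht : 2 * η ≤ t) : stepProfile η t = 2 := by
  unfold stepProfile
  rw [Real.smoothTransition.zero_of_nonpos (x := (-t - η) / η)
    (div_nonpos_of_nonpos_of_nonneg (by linarith) hη.le),
    Real.smoothTransition.one_of_one_le ((one_le_div hη).2 (by linarith))]
  norm_num

lemma deriv_stepProfile (hη : 0 < η) (ht : |t| < η) : deriv (stepProfile η) t = 0 := by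
  have : stepProfile η =ᶠ[nhds t] fun _ => 0 := by
    have ho : IsOpen {t : ℝ | |t| < η} := isOpen_lt continuous_abs continuous_const
    filter_upwards [ho.mem_nhds ht] with x hx
    have hx' := abs_lt.1 hx
    unfold stepProfile
    rw [Real.smoothTransition.zero_of_nonpos (div_nonpos_of_nonpos_of_nonneg (by linarith) hη.le),
      Real.smoothTransition.zero_of_nonpos (div_nonpos_of_nonpos_of_nonneg (by linarith) hη.le)]
    norm_num
  rw [this.deriv_eq]
  simp

lemma contDiff_hillProfile : ContDiff ℝ ∞ (hillProfile δ) := by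
  have h : ContDiff ℝ ∞ Real.smoothTransition := Real.smoothTransition.contDiff
  unfold hillProfile
  refine ContDiff.mul ?_ (h.comp ?_) <;> fun_prop

lemma hillProfile_eq_zero (hδ : 0 < δ) (hr : 1 - δ ≤ r) : hillProfile δ r = 0 := by
  unfold hillProfile
  rw [Real.smoothTransition.zero_of_nonpos (div_nonpos_of_nonpos_of_nonneg (by linarith) hδ.le),
    mul_zero]

lemma hillProfile_eq (hδ : 0 < δ) (hr : r ≤ 1 - 2 * δ) : hillProfile δ r = (1 - δ - r) / δ := by
  unfold hillProfile
  rw [Real.smoothTransition.one_of_one_le ((one_le_div hδ).2 (by linarith)), mul_one]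

lemma deriv_hillProfile (hδ : 0 < δ) (hr : 1 - δ < r) : deriv (hillProfile δ) r = 0 := by
  have : hillProfile δ =ᶠ[nhds r] fun _ => 0 := by
    filter_upwards [lt_mem_nhds hr] with x hx
    exact hillProfile_eq_zero hδ hx.le
  rw [this.deriv_eq]
  simp

end Profiles

/-! ### A ray missing the sections -/

/-- The comparison of the height `u` of a rotated point near the boundary of the disc with the
amount by which it is lifted. -/
lemma rotated_height_le {P U r H : ℝ} (hP : 0 ≤ P) (hP1 : P ≤ 1) (hU : 0 ≤ U) (hU1 : U ≤ 1 / 50)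
    (hr : 0 ≤ r) (hr2 : r ^ 2 = 1 - U ^ 2) (hH : H ^ 2 = r ^ 2 * (1 - P ^ 2 / 4) * U ^ 2) :
    Real.sin (P * (1 + 3 * H ^ 2)) ^ 2 + U ^ 2 * (1 - 2 * Real.sin (P * (1 + 3 * H ^ 2)) ^ 2)
      - 2 * (r * (P / 2)) * U * (Real.sin (P * (1 + 3 * H ^ 2)) * Real.cos (P * (1 + 3 * H ^ 2)))
      ≤ P ^ 2 + (H + H ^ 3) ^ 2 := by
  have hU2 : U ^ 2 ≤ 1 / 2500 := by nlinarith
  have hPsq : P ^ 2 ≤ 1 := by nlinarith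
  have hHU : H ^ 2 ≤ U ^ 2 := by
    rw [hH, hr2]
    have : (1 - U ^ 2) * (1 - P ^ 2 / 4) ≤ 1 := by nlinarith [sq_nonneg U, sq_nonneg P]
    nlinarith [sq_nonneg U]
  have hH0 : 0 ≤ H ^ 2 := sq_nonneg H
  set G := P * (1 + 3 * H ^ 2) with hG
  have hG0 : 0 ≤ G := by positivity
  have hPG : P ≤ G := by rw [hG]; nlinarith
  have hG1 : G ≤ 1.01 := by rw [hG]; nlinarith
  have hs2 : Real.sin G ^ 2 ≤ G ^ 2 := by
    have h1 := Real.sin_le hG0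
    have h2 := Real.sin_nonneg_of_nonneg_of_le_pi hG0 (by linarith [Real.pi_gt_three])
    nlinarith
  have hs : 0.6 * P ≤ Real.sin G := by
    have h1 := Real.mul_le_sin hG0 (by linarith [Real.pi_gt_three])
    have h2 : 0.6 ≤ 2 / Real.pi := by
      rw [le_div_iff₀ Real.pi_pos]; linarith [Real.pi_lt_d2]
    nlinarith
  have hc : 0.48 ≤ Real.cos G := by
    have := Real.one_sub_sq_div_two_le_cos (x := G)
    nlinarith
  have hsc : P / 4 ≤ Real.sin G * Real.cos G := by nlinarith
  have hr99 : 0.99 ≤ r := by nlinarith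
  -- The decisive gain: it is linear in U and comes from the second coordinate r P / 2 of the ray.
  -- The errors proportional to P² are only quadratic in U.
  have hterm : P ^ 2 * U / 5 ≤ 2 * (r * (P / 2)) * U * (Real.sin G * Real.cos G) := by
    have h1 : r * (P / 4) ≤ r * (Real.sin G * Real.cos G) := by gcongr
    have h2 : P / 5 ≤ r * (Real.sin G * Real.cos G) := by nlinarith
    have h3 : (P * U) * (P / 5) ≤ (P * U) * (r * (Real.sin G * Real.cos G)) := by gcongr
    nlinarith
  have hG2 : G ^ 2 ≤ P ^ 2 * (1 + 7 * U ^ 2) := by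
    rw [hG, mul_pow]
    have : (1 + 3 * H ^ 2) ^ 2 ≤ 1 + 7 * U ^ 2 := by nlinarith
    exact mul_le_mul_of_nonneg_left this (sq_nonneg P)
  have hHlow : U ^ 2 - U ^ 4 - P ^ 2 * U ^ 2 / 4 ≤ H ^ 2 := by
    rw [hH, hr2]
    nlinarith [mul_nonneg (sq_nonneg P) (pow_nonneg hU 4)]
  have hHlow2 : 0.72 * U ^ 2 ≤ H ^ 2 := by
    rw [hH, hr2]
    have : 0.72 ≤ (1 - U ^ 2) * (1 - P ^ 2 / 4) := by nlinarith
    exact mul_le_mul_of_nonneg_right this (sq_nonneg U)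
  -- For P = 0 one has H² = U² - U⁴, so the shift H alone would be too small. The term 2 H⁴ coming
  -- from the cubic part of the profile makes up for U⁴.
  have hH4 : U ^ 4 ≤ 2 * H ^ 4 := by
    have : (0.72 * U ^ 2) ^ 2 ≤ (H ^ 2) ^ 2 := by gcongr
    nlinarith [pow_nonneg hU 4]
  -- Here U ≤ 1/50 is used: 7.25 U ≤ 0.145 < 1/5.
  have hlast : P ^ 2 * (7 * U ^ 2 + U ^ 2 / 4) ≤ P ^ 2 * (U / 5) := by
    have : 7 * U ^ 2 + U ^ 2 / 4 ≤ U / 5 := by nlinarith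
    exact mul_le_mul_of_nonneg_left this (sq_nonneg P)
  have hexp : (H + H ^ 3) ^ 2 = H ^ 2 + 2 * H ^ 4 + H ^ 6 := by ring
  have h6 : 0 ≤ H ^ 6 := by positivity
  have h7 : 0 ≤ U ^ 2 * Real.sin G ^ 2 := by positivity
  rw [hexp]
  linarith

/-- The height lost under the inverse of a rotation. -/
lemma one_sub_rotZ_div_two {q p : ℝ} (h : q ^ 2 + p ^ 2 < 1) (G : ℝ) :
    (1 - rotZ q p (-(2 * G))) / 2 = Real.sin G ^ 2
      + coheight q p ^ 2 * (1 - 2 * Real.sin G ^ 2)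
      - 2 * p * coheight q p * (Real.sin G * Real.cos G) := by
  rw [rotZ, Real.cos_neg, Real.sin_neg, Real.cos_two_mul, Real.sin_two_mul]
  have hu := coheight_sq h
  linear_combination (-1 + 2 * Real.sin G ^ 2) * hu
    - (2 * (q ^ 2 + p ^ 2) - 1) * Real.sin_sq_add_cos_sq G

/-- The function `t ↦ t + t³`. -/
def cubicProfile (t : ℝ) : ℝ := t + t ^ 3

lemma hasDerivAt_cubicProfile (t : ℝ) : HasDerivAt cubicProfile (1 + 3 * t ^ 2) t :=
  ((hasDerivAt_id t).add (hasDerivAt_pow 3 t)).congr_deriv (by simp)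

lemma contDiff_cubicProfile : ContDiff ℝ ∞ cubicProfile := by
  unfold cubicProfile; fun_prop

/-- The symplectic embedding with thin sections. -/
def thinEmbedding (m : ℕ) (d : ℝ) : PhaseSpace (m + 2) → PhaseSpace (m + 2) :=
  sphereLift (stepProfile (d ^ 3)) (deriv (stepProfile (d ^ 3))) ∘
    radialLift (hillProfile (d ^ 2)) (deriv (hillProfile (d ^ 2))) ∘
    sphereLift cubicProfile (fun t => 1 + 3 * t ^ 2)

/-! ### The thin embedding, its sections and their hulls -/

section ThinEmbedding

variable {m : ℕ} {d : ℝ}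

lemma sum_sq_lt_of_mem_ball {x : PhaseSpace (m + 2)} (hx : x ∈ Metric.ball 0 1) :
    x (0, 0) ^ 2 + x (0, 1) ^ 2 + (x (1, 0) ^ 2 + x (1, 1) ^ 2) < 1 := by
  have h1 : ‖x‖ ^ 2 < 1 := by
    rw [mem_ball_zero_iff] at hx
    nlinarith [norm_nonneg x]
  rw [EuclideanSpace.norm_sq_eq, Fintype.sum_prod_type, Fin.sum_univ_succ (n := m + 1),
    Fin.sum_univ_succ (n := m)] at h1
  have h2 : 0 ≤ ∑ i : Fin m, ∑ j : Fin 2, ‖x (i.succ.succ, j)‖ ^ 2 := by positivity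
  simp only [Fin.sum_univ_two, Real.norm_eq_abs, sq_abs, Fin.succ_zero_eq_one] at h1 h2
  linarith

/-- Only points with q = 0 matter, and they turn by 2 p₂. Reaching the missing point would force 2p²
- 1 = cos(2 p₂) ≥ 1 - 2 p₂², hence p² + p₂² ≥ 1, which is impossible in the ball. -/
lemma ball_subset_sphereLiftDomain :
    Metric.ball 0 1 ⊆ sphereLiftDomain m (fun t => 1 + 3 * t ^ 2) := by
  intro x hx
  have hs := sum_sq_lt_of_mem_ball hx
  have hlt : x (0, 0) ^ 2 + x (0, 1) ^ 2 < 1 := by nlinarith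
  refine ⟨hlt, rotZ_lt_one hlt fun h0 => ?_⟩
  have hu := coheight_sq hlt
  have hq : x (0, 0) = 0 := by
    rcases mul_eq_zero.1 h0 with h | h
    · exact h
    · exact absurd h (coheight_pos hlt).ne'
  have hsph := rot_sphere (b := liftAngle (fun t => 1 + 3 * t ^ 2) x) hlt
  have hang : liftAngle (fun t => 1 + 3 * t ^ 2) x = 2 * x (1, 1) := by
    simp [liftAngle, h0]
  rw [h0, hang] at hsph
  rw [hang]
  by_contra! hge
  have hY : rotY (x (0, 0)) (x (0, 1)) (2 * x (1, 1)) = 0 := by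
    nlinarith [sq_nonneg (rotY (x (0, 0)) (x (0, 1)) (2 * x (1, 1)))]
  have hZ : rotZ (x (0, 0)) (x (0, 1)) (2 * x (1, 1)) = 1 := by nlinarith
  rw [rotY] at hY
  rw [rotZ] at hZ
  have h3 : 2 * (x (0, 0) ^ 2 + x (0, 1) ^ 2) - 1 = Real.cos (2 * x (1, 1)) := by
    linear_combination Real.sin (2 * x (1, 1)) * hY + Real.cos (2 * x (1, 1)) * hZ
      - (2 * (x (0, 0) ^ 2 + x (0, 1) ^ 2) - 1) * Real.sin_sq_add_cos_sq (2 * x (1, 1))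
  rw [Real.cos_two_mul] at h3
  have h4 := Real.one_sub_sq_div_two_le_cos (x := 2 * x (1, 1))
  rw [Real.cos_two_mul] at h4
  nlinarith [sq_nonneg (x (1, 0))]

lemma contDiff_deriv_stepProfile {η : ℝ} : ContDiff ℝ ∞ (deriv (stepProfile η)) :=
  contDiff_stepProfile.iterate_deriv 1

lemma contDiff_deriv_hillProfile {δ : ℝ} : ContDiff ℝ ∞ (deriv (hillProfile δ)) :=
  contDiff_hillProfile.iterate_deriv 1

lemma deriv_stepProfile_zero (hd : 0 < d) : deriv (stepProfile (d ^ 3)) 0 = 0 :=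
  deriv_stepProfile (by positivity) (by simpa using pow_pos hd 3)

lemma mem_sphereLiftDomain_of_apply_zero {g : ℝ → ℝ} (hg : g 0 = 0) {x : PhaseSpace (m + 2)}
    (hx : x (0, 0) ^ 2 + x (0, 1) ^ 2 < 1) : x ∈ sphereLiftDomain m g :=
  ⟨hx, rotZ_lt_one_of_apply_zero hg hx⟩

lemma radialLift_sphereLift_mem {f g k l : ℝ → ℝ} {x : PhaseSpace (m + 2)}
    (hx : x ∈ sphereLiftDomain m g) :
    radialLift k l (sphereLift f g x) (0, 0) ^ 2 + radialLift k l (sphereLift f g x) (0, 1) ^ 2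
      < 1 := by
  rw [radialLift_norm_sq]
  exact rot_norm_lt hx.1 hx.2

lemma isSymplecticEmbeddingOn_thinEmbedding (hd : 0 < d) :
    IsSymplecticEmbeddingOn (thinEmbedding m d) (Metric.ball 0 1) := by
  have h1 : IsSymplecticEmbeddingOn (sphereLift (m := m) cubicProfile (fun t => 1 + 3 * t ^ 2))
      (Metric.ball 0 1) :=
    (isSymplecticEmbeddingOn_sphereLift contDiff_cubicProfile (by fun_prop)
      hasDerivAt_cubicProfile).mono Metric.isOpen_ball ball_subset_sphereLiftDomain
  have h2 := isSymplecticEmbeddingOn_radialLift (m := m)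
    (contDiff_hillProfile (δ := d ^ 2)) contDiff_deriv_hillProfile
    (fun t => (contDiff_hillProfile.differentiable (by simp) t).hasDerivAt)
  have h3 := isSymplecticEmbeddingOn_sphereLift (m := m)
    (contDiff_stepProfile (η := d ^ 3)) contDiff_deriv_stepProfile
    (fun t => (contDiff_stepProfile.differentiable (by simp) t).hasDerivAt)
  refine h3.comp (h2.comp h1 (mapsTo_univ _ _)) fun x hx => ?_
  exact mem_sphereLiftDomain_of_apply_zero (deriv_stepProfile_zero hd)
    (radialLift_sphereLift_mem (ball_subset_sphereLiftDomain hx))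

/-- The sections of the image of `thinEmbedding` at `z` with first pair `(s, t)` are contained in
the image of this set under a twist. -/
def sectionBound (d s t : ℝ) : Set Plane :=
  {y | y 0 ^ 2 + y 1 ^ 2 < 1 ∧ |t - hillProfile (d ^ 2) (y 0 ^ 2 + y 1 ^ 2)| < 1 ∧
    |s - stepProfile (d ^ 3) (discHam (y 0) (y 1))| < 2 ∧
    (1 - d ^ 2 < y 0 ^ 2 + y 1 ^ 2 →
      (s - stepProfile (d ^ 3) (discHam (y 0) (y 1)) - cubicProfile (discHam (y 0) (y 1))) ^ 2
        + t ^ 2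
      < (1 - rotZ (y 0) (y 1) (-(2 * (t * (1 + 3 * discHam (y 0) (y 1) ^ 2))))) / 2)}

lemma abs_discHam_le {q p : ℝ} (h : q ^ 2 + p ^ 2 < 1) : |discHam q p| ≤ 1 / 2 := by
  have hu := coheight_sq h
  rw [abs_le, discHam]
  constructor
  · nlinarith [sq_nonneg (q + coheight q p), sq_nonneg p]
  · nlinarith [sq_nonneg (q - coheight q p), sq_nonneg p]

/-- The bound on the hill comes from |p₂| < 1 on the ball, and the bound on the step from |q₂| < 1
and |H + H³| ≤ 5/8. In the last condition the hill vanishes, so the radial map does nothing and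
undoing the first rotation recovers the original point; the condition is then q₂² + p₂² < 1 - r²
there. -/
lemma lifted_mem_sectionBound (hd : 0 < d) {x y : PhaseSpace (m + 2)} (hx : x ∈ Metric.ball 0 1)
    (hy : y = radialLift (hillProfile (d ^ 2)) (deriv (hillProfile (d ^ 2)))
      (sphereLift cubicProfile (fun t => 1 + 3 * t ^ 2) x)) :
    !₂[y (0, 0), y (0, 1)] ∈ sectionBound d
      (y (1, 0) + stepProfile (d ^ 3) (discHam (y (0, 0)) (y (0, 1)))) (y (1, 1)) := by
  have hdom := ball_subset_sphereLiftDomain hx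
  have hs := sum_sq_lt_of_mem_ball hx
  set x₁ := sphereLift cubicProfile (fun t => 1 + 3 * t ^ 2) x with hx₁
  have hr : y (0, 0) ^ 2 + y (0, 1) ^ 2 = x₁ (0, 0) ^ 2 + x₁ (0, 1) ^ 2 := by
    rw [hy, radialLift_norm_sq]
  have hlt : x₁ (0, 0) ^ 2 + x₁ (0, 1) ^ 2 < 1 := rot_norm_lt hdom.1 hdom.2
  have hq : y (1, 0) = x (1, 0) + cubicProfile (discHam (x (0, 0)) (x (0, 1))) := by
    rw [hy]; rfl
  have hp : y (1, 1) = x (1, 1) + hillProfile (d ^ 2) (x₁ (0, 0) ^ 2 + x₁ (0, 1) ^ 2) := by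
    rw [hy]; rfl
  have hH₁ : discHam (x₁ (0, 0)) (x₁ (0, 1)) = discHam (x (0, 0)) (x (0, 1)) :=
    discHam_rot hdom.1 hdom.2
  refine ⟨?_, ?_, ?_, ?_⟩
  · simpa [hr] using hlt
  · have : |x (1, 1)| < 1 := by rw [abs_lt]; constructor <;> nlinarith
    simpa [hr, hp] using this
  · have h1 := abs_discHam_le hdom.1
    rw [abs_le] at h1
    have hx2 : x (1, 0) ^ 2 < 1 := by nlinarith
    have hx3 : x (1, 0) < 1 := by nlinarith
    have hx4 : -1 < x (1, 0) := by nlinarith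
    have h5 : discHam (x (0, 0)) (x (0, 1)) ^ 2 ≤ 1 := by nlinarith
    have h2 : |y (1, 0)| < 2 := by
      rw [hq, cubicProfile, abs_lt]
      constructor <;> nlinarith
    simpa using h2
  · intro hnear
    have hnear' : 1 - d ^ 2 < x₁ (0, 0) ^ 2 + x₁ (0, 1) ^ 2 := by simpa [hr] using hnear
    have hl : deriv (hillProfile (d ^ 2)) (x₁ (0, 0) ^ 2 + x₁ (0, 1) ^ 2) = 0 :=
      deriv_hillProfile (by positivity) hnear'
    have hy₀ : y (0, 0) = x₁ (0, 0) := by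
      rw [hy]; simp [radialLift, hl]
    have hy₁ : y (0, 1) = x₁ (0, 1) := by
      rw [hy]; simp [radialLift, hl]
    have hp' : y (1, 1) = x (1, 1) := by
      rw [hp, hillProfile_eq_zero (by positivity) hnear'.le, add_zero]
    have hrot : rotZ (x₁ (0, 0)) (x₁ (0, 1))
        (-(2 * (x (1, 1) * (1 + 3 * discHam (x (0, 0)) (x (0, 1)) ^ 2))))
        = 2 * (x (0, 0) ^ 2 + x (0, 1) ^ 2) - 1 := by
      have hang : liftAngle (fun t => 1 + 3 * t ^ 2) x
          = 2 * (x (1, 1) * (1 + 3 * discHam (x (0, 0)) (x (0, 1)) ^ 2)) := by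
        simp only [liftAngle]; ring
      rw [← hang]
      exact rotZ_rot_neg hdom.1 hdom.2
    simp only [Matrix.cons_val_zero, Matrix.cons_val_one]
    rw [hy₀, hy₁, hH₁, hp', hrot, hq]
    ring_nf
    ring_nf at hs
    linarith

lemma thinEmbedding_mapsTo (hd : 0 < d) :
    MapsTo (thinEmbedding m d) (Metric.ball 0 1) (openCylinder (m + 2) 1) := by
  intro x hx
  have h := mem_sphereLiftDomain_of_apply_zero (deriv_stepProfile_zero hd)
    (radialLift_sphereLift_mem (f := cubicProfile) (k := hillProfile (d ^ 2))
      (l := deriv (hillProfile (d ^ 2))) (ball_subset_sphereLiftDomain hx))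
  have hlt := rot_norm_lt h.1 h.2
  set y := thinEmbedding m d x with hy
  have hy' : y (0, 0) ^ 2 + y (0, 1) ^ 2 < 1 := hlt
  refine ⟨!₂[y (0, 0), y (0, 1)], ?_, WithLp.toLp 2 fun k => y (k.1.succ, k.2), ?_⟩
  · rw [mem_ball_zero_iff, ← sq_lt_one_iff₀ (norm_nonneg _), plane_norm_sq]
    simpa using hy'
  · ext ⟨i, j⟩
    refine Fin.cases ?_ (fun i => ?_) i
    · fin_cases j <;> simp [planeInclusion]
    · simp [planeInclusion]
      rfl

/-- The last map fixes p₂, so over p₂ = t it acts on the first pair as the twist with parameter t.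
Because it also preserves H, the earlier q₂ is s minus the step at H. -/
lemma planeSection_subset (hd : 0 < d) (z : PhaseSpace (m + 2 - 1)) :
    planeSection (thinEmbedding m d '' Metric.ball 0 1) z
      ⊆ diskTwist (deriv (stepProfile (d ^ 3))) (z (⟨0, by omega⟩, 1)) ''
        sectionBound d (z (⟨0, by omega⟩, 0)) (z (⟨0, by omega⟩, 1)) := by
  rintro y ⟨x, hx, hxy⟩
  obtain ⟨w, hw⟩ : ∃ w, w = radialLift (hillProfile (d ^ 2)) (deriv (hillProfile (d ^ 2)))
      (sphereLift cubicProfile (fun t => 1 + 3 * t ^ 2) x) := ⟨_, rfl⟩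
  have hmem := lifted_mem_sectionBound hd hx hw
  have hxy' : sphereLift (stepProfile (d ^ 3)) (deriv (stepProfile (d ^ 3))) w
      = planeInclusion z y := by rw [hw]; exact hxy
  have hs : z (⟨0, by omega⟩, 0)
      = w (1, 0) + stepProfile (d ^ 3) (discHam (w (0, 0)) (w (0, 1))) :=
    (congrArg (fun v : PhaseSpace (m + 2) => v (1, 0)) hxy').symm
  have ht : z (⟨0, by omega⟩, 1) = w (1, 1) :=
    (congrArg (fun v : PhaseSpace (m + 2) => v (1, 1)) hxy').symm
  refine ⟨!₂[w (0, 0), w (0, 1)], by rw [hs, ht]; exact hmem, ?_⟩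
  rw [diskTwist_of_lt hmem.1, ht]
  ext j
  have h0 := congrArg (fun v : PhaseSpace (m + 2) => v (0, 0)) hxy'
  have h1 := congrArg (fun v : PhaseSpace (m + 2) => v (0, 1)) hxy'
  fin_cases j
  · exact h0
  · exact h1

lemma rotZ_ge_neg_one {q p b : ℝ} (h : q ^ 2 + p ^ 2 < 1) : -1 ≤ rotZ q p b := by
  have := rot_sphere (b := b) h
  nlinarith [sq_nonneg (2 * discHam q p), sq_nonneg (rotY q p b)]

/-- Some ray misses `sectionBound d s t` outside of a small disc. -/
lemma exists_ray (hd : 0 < d) (hd1 : d ≤ 1 / 50) (s t : ℝ) :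
    ∃ a b : ℝ, a ^ 2 + b ^ 2 = 1 ∧
      ∀ r : ℝ, 4 * d ^ 2 ≤ r → (!₂[r * a, r * b] : Plane) ∉ sectionBound d s t := by
  -- The ray points into the half of the disc whose step, of sign σ, leads away from s.
  obtain ⟨σ, hσ, hσs⟩ : ∃ σ : ℝ, (σ = 1 ∨ σ = -1) ∧ σ * s ≤ 0 := by
    rcases le_total s 0 with h | h
    · exact ⟨1, Or.inl rfl, by linarith⟩
    · exact ⟨-1, Or.inr rfl, by linarith⟩
  have hσ2 : σ ^ 2 = 1 := by rcases hσ with h | h <;> rw [h] <;> norm_num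
  -- The tilt t / 2 yields the term linear in U in `rotated_height_le`. For |t| > 1 no tilt is
  -- needed.
  obtain ⟨b, hb2, hb⟩ : ∃ b : ℝ, b ^ 2 ≤ 1 / 4 ∧ (|t| ≤ 1 → b = t / 2) := by
    by_cases h : |t| ≤ 1
    · refine ⟨t / 2, ?_, fun _ => rfl⟩
      have : t ^ 2 ≤ 1 := by rw [← sq_abs]; nlinarith [abs_nonneg t]
      linarith
    · exact ⟨0, by norm_num, fun h' => absurd h' h⟩
  set c := √(1 - b ^ 2) with hc
  have hc2 : c ^ 2 = 1 - b ^ 2 := Real.sq_sqrt (by linarith)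
  have hc0 : 1 / 2 ≤ c := Real.le_sqrt_of_sq_le (by linarith)
  refine ⟨σ * c, b, by rw [mul_pow, hσ2, hc2]; ring, ?_⟩
  rintro r hr ⟨h1, -, h3, h4⟩
  simp only [Matrix.cons_val_zero, Matrix.cons_val_one] at h1 h3 h4
  have hr0 : 0 < r := lt_of_lt_of_le (by positivity) hr
  have hn : (r * (σ * c)) ^ 2 + (r * b) ^ 2 = r ^ 2 := by
    linear_combination r ^ 2 * c ^ 2 * hσ2 + r ^ 2 * hc2
  set U := coheight (r * (σ * c)) (r * b) with hU
  have hU2 : U ^ 2 = 1 - r ^ 2 := by rw [hU, coheight_sq h1, hn]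
  have hU0 : 0 < U := coheight_pos h1
  set h := r * c * U with hh
  have hh0 : 0 < h := by positivity
  have hH : discHam (r * (σ * c)) (r * b) = σ * h := by
    rw [discHam, hh]; ring
  have hstep : ∀ v, stepProfile (d ^ 3) (σ * v) = σ * stepProfile (d ^ 3) v := by
    intro v
    rcases hσ with h | h <;> rw [h]
    · simp
    · simp [stepProfile_neg]
  rw [hH, hstep] at h3 h4
  rcases le_or_gt d U with hdU | hdU
  -- Away from the circle, r ≥ 4d², c ≥ 1/2 and U ≥ d give H the size 2d³ at which the step is full.
  -- Then |s - 2σ| = |s| + 2 contradicts the bound 2.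
  · have h5 : 2 * d ^ 3 ≤ h := by
      have : 4 * d ^ 2 * (1 / 2) * d ≤ r * c * U := by gcongr
      calc 2 * d ^ 3 = 4 * d ^ 2 * (1 / 2) * d := by ring
        _ ≤ h := this
    rw [stepProfile_eq_two (by positivity) h5, abs_lt] at h3
    rcases hσ with h | h <;> rw [h] at h3 hσs <;> linarith
  · have h6 := h4 (by rw [hn]; nlinarith)
    -- Near the circle the step may be partial. If |t| > 1, the ball leaves no room, as (1 - Z) / 2
    -- ≤ 1.
    rcases lt_or_ge 1 |t| with ht | ht
    · have h7 : 1 < t ^ 2 := by rw [← sq_abs]; nlinarith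
      have h8 := rotZ_ge_neg_one (b := -(2 * (t * (1 + 3 * (σ * h) ^ 2)))) h1
      nlinarith [sq_nonneg (s - σ * stepProfile (d ^ 3) h - cubicProfile (σ * h))]
    · rw [one_sub_rotZ_div_two h1, ← hU, hb ht] at h6
      have hsq : (σ * h) ^ 2 = h ^ 2 := by rw [mul_pow, hσ2, one_mul]
      rw [hsq] at h6
      -- Up to the factor -σ, the three terms -σ s, step and cubic shift are all nonnegative, so the
      -- cubic shift alone bounds the square from below.
      have hlift : (h + h ^ 3) ^ 2
          ≤ (s - σ * stepProfile (d ^ 3) h - cubicProfile (σ * h)) ^ 2 := by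
        have hstep0 := stepProfile_nonneg (η := d ^ 3) (by positivity) hh0.le
        have e : (s - σ * stepProfile (d ^ 3) h - cubicProfile (σ * h)) ^ 2
            = (-(σ * s) + stepProfile (d ^ 3) h + (h + h ^ 3)) ^ 2 := by
          rcases hσ with h | h <;> rw [h, cubicProfile] <;> ring
        rw [e]
        exact pow_le_pow_left₀ (by positivity) (by linarith) 2
      have key := rotated_height_le (P := |t|) (U := U) (r := r) (H := h) (abs_nonneg t) ht
        hU0.le (by linarith) hr0.le (by linarith) (by
          rw [hh, mul_pow, mul_pow, hc2, hb ht, sq_abs]; ring)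
      -- `rotated_height_le` is applied with P = |t|; its left side is even in t because the tilt
      -- changes sign with t.
      have heven : Real.sin (|t| * (1 + 3 * h ^ 2)) ^ 2 + U ^ 2
            * (1 - 2 * Real.sin (|t| * (1 + 3 * h ^ 2)) ^ 2)
          - 2 * (r * (|t| / 2)) * U
            * (Real.sin (|t| * (1 + 3 * h ^ 2)) * Real.cos (|t| * (1 + 3 * h ^ 2)))
          = Real.sin (t * (1 + 3 * h ^ 2)) ^ 2 + U ^ 2
            * (1 - 2 * Real.sin (t * (1 + 3 * h ^ 2)) ^ 2)
          - 2 * (r * (t / 2)) * U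
            * (Real.sin (t * (1 + 3 * h ^ 2)) * Real.cos (t * (1 + 3 * h ^ 2))) := by
        rcases abs_cases t with ⟨h, -⟩ | ⟨h, -⟩ <;> rw [h]
        rw [neg_mul, Real.sin_neg, Real.cos_neg]
        ring
      rw [heven, sq_abs] at key
      linarith

/-- A rotationally symmetric set of small area containing `sectionBound d s t`. -/
def radialBound (d t : ℝ) : Set Plane :=
  {y | y 0 ^ 2 + y 1 ^ 2 < 1 ∧ (1 - 2 * d ^ 2 < y 0 ^ 2 + y 1 ^ 2 ∨
    |t - (1 - d ^ 2 - (y 0 ^ 2 + y 1 ^ 2)) / d ^ 2| < 1 ∨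
    y 0 ^ 2 + y 1 ^ 2 < (4 * d ^ 2) ^ 2)}

lemma sectionBound_subset_radialBound (hd : 0 < d) (s t : ℝ) :
    sectionBound d s t ⊆ radialBound d t := by
  rintro y ⟨h1, h2, -⟩
  refine ⟨h1, ?_⟩
  rcases lt_or_ge (1 - 2 * d ^ 2) (y 0 ^ 2 + y 1 ^ 2) with h | h
  · exact Or.inl h
  · rw [hillProfile_eq (by positivity) h] at h2
    exact Or.inr (Or.inl h2)

lemma measurableSet_radialBound (t : ℝ) : MeasurableSet (radialBound d t) := by
  have hc : Continuous fun y : Plane => y 0 ^ 2 + y 1 ^ 2 := by fun_prop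
  exact (isOpen_unitDisk.inter ((isOpen_lt continuous_const hc).union
    ((isOpen_lt (continuous_const.sub ((continuous_const.sub hc).div_const _)).abs
    continuous_const).union (isOpen_lt hc continuous_const)))).measurableSet

lemma volume_radialBound_le (hd : 0 < d) (hd1 : d ≤ 1 / 50) (t : ℝ) :
    volume (radialBound d t) ≤ ENNReal.ofReal d := by
  -- The three pieces have areas at most 2πd², 2πd² and π(d² + 16d⁴). The negative lower bound -d²
  -- keeps the centre inside the last one.
  have hsub : radialBound d t ⊆
      ({y | 1 - 2 * d ^ 2 < y 0 ^ 2 + y 1 ^ 2 ∧ y 0 ^ 2 + y 1 ^ 2 < 1} ∪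
      {y | 1 - 2 * d ^ 2 - d ^ 2 * t < y 0 ^ 2 + y 1 ^ 2 ∧ y 0 ^ 2 + y 1 ^ 2 < 1 - d ^ 2 * t}) ∪
      {y | -d ^ 2 < y 0 ^ 2 + y 1 ^ 2 ∧ y 0 ^ 2 + y 1 ^ 2 < (4 * d ^ 2) ^ 2} := by
    have hd2 : 0 < d ^ 2 := by positivity
    rintro y ⟨h1, h | h | h⟩
    · exact Or.inl (Or.inl ⟨h, h1⟩)
    · refine Or.inl (Or.inr ?_)
      have e : t - (1 - d ^ 2 - (y 0 ^ 2 + y 1 ^ 2)) / d ^ 2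
          = (d ^ 2 * t - (1 - d ^ 2 - (y 0 ^ 2 + y 1 ^ 2))) / d ^ 2 := by
        field_simp
      rw [e, abs_div, abs_of_pos hd2, div_lt_one hd2, abs_lt] at h
      constructor <;> linarith
    · exact Or.inr ⟨by nlinarith [sq_nonneg (y 0), sq_nonneg (y 1)], h⟩
  refine (measure_mono hsub).trans ((measure_union_le _ _).trans
    ((add_le_add (measure_union_le _ _) le_rfl).trans ((add_le_add (add_le_add
      (volume_annulus_le _ _) (volume_annulus_le _ _)) (volume_annulus_le _ _)).trans ?_)))
  have hpi := Real.pi_pos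
  rw [← ENNReal.ofReal_add (mul_nonneg hpi.le (by nlinarith)) (mul_nonneg hpi.le (by nlinarith)),
    ← ENNReal.ofReal_add (add_nonneg (mul_nonneg hpi.le (by nlinarith))
      (mul_nonneg hpi.le (by nlinarith))) (mul_nonneg hpi.le (by nlinarith))]
  refine ENNReal.ofReal_le_ofReal ?_
  have h4 := Real.pi_le_four
  have hd2 : d ^ 2 ≤ d / 50 := by nlinarith
  have h5 : Real.pi * (1 - (1 - 2 * d ^ 2))
      + Real.pi * (1 - d ^ 2 * t - (1 - 2 * d ^ 2 - d ^ 2 * t))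
      + Real.pi * ((4 * d ^ 2) ^ 2 - -d ^ 2) = Real.pi * (5 * d ^ 2 + 16 * (d ^ 2 * d ^ 2)) := by
    ring
  rw [h5]
  have h6 : 5 * d ^ 2 + 16 * (d ^ 2 * d ^ 2) ≤ d / 4 := by nlinarith [sq_nonneg d]
  nlinarith [sq_nonneg d]

lemma boundedHull_planeSection_subset (hd : 0 < d) (hd1 : d ≤ 1 / 50)
    (z : PhaseSpace (m + 2 - 1)) :
    boundedHull (planeSection (thinEmbedding m d '' Metric.ball 0 1) z)
      ⊆ diskTwist (deriv (stepProfile (d ^ 3))) (z (⟨0, by omega⟩, 1)) ''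
        radialBound d (z (⟨0, by omega⟩, 1)) := by
  have hS := planeSection_subset hd z
  set s := z (⟨0, by omega⟩, 0)
  set t := z (⟨0, by omega⟩, 1)
  set Φ := diskTwist (deriv (stepProfile (d ^ 3))) t with hΦ
  have hg0 := deriv_stepProfile_zero hd
  have hinj : Function.Injective Φ := diskTwist_injective hg0 t
  have hcont : Continuous Φ := continuous_diskTwist contDiff_deriv_stepProfile (pow_pos hd 3)
    fun u hu => deriv_stepProfile (by positivity) hu
  refine boundedHull_subset (hS.trans (image_mono (sectionBound_subset_radialBound hd s t)))
    fun x hx => ?_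
  obtain ⟨y, rfl⟩ : ∃ y, Φ y = x := ⟨_, diskTwist_diskTwist_neg hg0 t x⟩
  have hy : y ∉ radialBound d t := fun h => hx (mem_image_of_mem _ h)
  -- it suffices to find a connected set through `y` that contains the end of a ray
  suffices h : ∃ K : Set Plane, IsPreconnected K ∧ y ∈ K ∧ K ⊆ (sectionBound d s t)ᶜ ∧
      ∃ e : Plane, e ≠ 0 ∧ ∀ r : ℝ, 1 ≤ r → ‖r • e‖ ≥ 1 ∧ r • e ∈ K by
    obtain ⟨K, hK, hyK, hKS, e, he, hr⟩ := h
    refine ⟨Φ '' K, hK.image _ hcont.continuousOn, mem_image_of_mem _ hyK, ?_, fun hb => ?_⟩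
    · rintro _ ⟨v, hv, rfl⟩ hvS
      obtain ⟨v', hv', he⟩ := hS hvS
      rw [hinj he] at hv'
      exact hKS hv hv'
    · obtain ⟨C, hC⟩ := hb.exists_norm_le
      have hen : 0 < ‖e‖ := norm_pos_iff.2 he
      set r := max 1 ((C + 1) / ‖e‖) with hr'
      obtain ⟨h1, h2⟩ := hr r (le_max_left _ _)
      -- The twist is the identity outside the unit disc, so the image of the ray is still
      -- unbounded.
      have hfix : Φ (r • e) = r • e := by
        refine diskTwist_of_not_lt ?_
        rw [← plane_norm_sq, not_lt]
        nlinarith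
      have h3 := hC _ (mem_image_of_mem Φ h2)
      rw [hfix, norm_smul, Real.norm_of_nonneg (zero_le_one.trans (le_max_left _ _))] at h3
      have h4 : C + 1 ≤ r * ‖e‖ := (div_le_iff₀ hen).1 (le_max_right _ _)
      linarith
  have hray : ∀ (e : Plane) (r₀ : ℝ), IsPreconnected ((fun r : ℝ => r • e) '' Ici r₀) :=
    fun e r₀ => isPreconnected_Ici.image _ (by fun_prop)
  rcases lt_or_ge (y 0 ^ 2 + y 1 ^ 2) 1 with hy1 | hy1
  · obtain ⟨a, b, hab, hmiss⟩ := exists_ray hd hd1 s t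
    set e : Plane := !₂[a, b] with he
    have hen : ‖e‖ = 1 := by
      rw [← sq_eq_sq₀ (norm_nonneg _) zero_le_one, plane_norm_sq]
      simpa [he] using hab
    have hsmul : ∀ r : ℝ, r • e = !₂[r * a, r * b] := by
      intro r
      ext i
      fin_cases i <;> simp [he]
    -- `radialBound` contains the disc of radius 4d², where the ray gives no control. So the circle
    -- through y meets the usable part of the ray.
    have hny : 4 * d ^ 2 ≤ ‖y‖ := by
      by_contra! hlt
      refine hy ⟨hy1, Or.inr (Or.inr ?_)⟩
      rw [← plane_norm_sq]
      gcongr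
    refine ⟨Metric.sphere 0 ‖y‖ ∪ (fun r : ℝ => r • e) '' Ici (4 * d ^ 2), ?_, ?_, ?_, e, ?_, ?_⟩
    · refine IsPreconnected.union (‖y‖ • e) ?_ ⟨‖y‖, hny, rfl⟩ (isPreconnected_sphere ?_ _ _)
        (hray _ _)
      · simp [norm_smul, hen]
      · rw [← Module.finrank_eq_rank]
        simp
    · left; simp
    · rintro v (hv | ⟨r, hr, rfl⟩) hvS
      · have hvy : v 0 ^ 2 + v 1 ^ 2 = y 0 ^ 2 + y 1 ^ 2 := by
          rw [← plane_norm_sq, ← plane_norm_sq, mem_sphere_zero_iff_norm.1 hv]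
        have := sectionBound_subset_radialBound hd s t hvS
        rw [radialBound, mem_ofPred_eq, hvy] at this
        exact hy this
      · have hvS' : r • e ∈ sectionBound d s t := hvS
        rw [hsmul] at hvS'
        exact hmiss r hr hvS'
    · rw [← norm_pos_iff, hen]; exact one_pos
    · intro r hr
      refine ⟨?_, Or.inr ⟨r, ?_, rfl⟩⟩
      · rw [norm_smul, hen, mul_one, Real.norm_of_nonneg (by linarith)]; exact hr
      · rw [mem_Ici]; nlinarith
  · have hny : 1 ≤ ‖y‖ := by
      rw [← plane_norm_sq] at hy1
      nlinarith [norm_nonneg y]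
    have hn : ∀ r : ℝ, 1 ≤ r → 1 ≤ ‖r • y‖ := by
      intro r hr
      rw [norm_smul, Real.norm_of_nonneg (by linarith)]
      nlinarith
    refine ⟨(fun r : ℝ => r • y) '' Ici 1, hray _ _, ⟨1, self_mem_Ici, one_smul _ _⟩, ?_, y, ?_, ?_⟩
    · rintro _ ⟨r, hr, rfl⟩ hvS
      have h1 := hvS.1
      rw [← plane_norm_sq] at h1
      nlinarith [hn r hr]
    · rintro rfl
      norm_num at hny
    · exact fun r hr => ⟨hn r hr, r, hr, rfl⟩

end ThinEmbedding

end

theorem corollary2 (n : ℕ) (hn : 2 ≤ n) (a : ℝ) (ha : 0 < a) :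
    ∃ ψ : PhaseSpace n → PhaseSpace n,
      IsSymplecticEmbeddingOn ψ (Metric.ball 0 1) ∧
      MapsTo ψ (Metric.ball 0 1) (openCylinder n 1) ∧
      ∀ z : PhaseSpace (n - 1),
        volume (boundedHull (planeSection (ψ '' Metric.ball 0 1) z)) ≤ ENNReal.ofReal a := by
  obtain ⟨m, rfl⟩ : ∃ m, n = m + 2 := ⟨n - 2, by omega⟩
  -- The bound 1/50 serves the estimates near the circle and for the area; the bound a suffices
  -- because the area is at most d.
  have hd : 0 < min (1 / 50) a := lt_min (by norm_num) ha
  have hd1 : min (1 / 50) a ≤ 1 / 50 := min_le_left _ _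
  refine ⟨thinEmbedding m (min (1 / 50) a), isSymplecticEmbeddingOn_thinEmbedding hd,
    thinEmbedding_mapsTo hd, fun z => ?_⟩
  exact (measure_mono (boundedHull_planeSection_subset hd hd1 z)).trans
    ((volume_diskTwist_image_le contDiff_deriv_stepProfile (deriv_stepProfile_zero hd)
      (measurableSet_radialBound _) fun y hy => hy.1).trans
    ((volume_radialBound_le hd hd1 _).trans (ENNReal.ofReal_le_ofReal (min_le_right _ _))))
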